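/- Let $g\ge 2$. In the Poincaré disk $\mathbb D$ with its hyperbolic distance $d$ (curvature $-1$), let $D_g$ be the closed regular hyperbolic $4g$-gon centered at the origin with angle sum $2\pi$, with vertices $v_0,\dots,v_{4g-1}$ in counterclockwise order (indices modulo $4g$), placed so that the midpoint of the side from $v_0$ to $v_1$ lies on the positive real axis; let $s_j$ be the side with endpoints $v_j,v_{j+1}$. For $0\le j<4g$ let $f_j$ be the orientation-preserving isometry $$f_j(z)=\frac{az+b_j}{\overline{b_j}\,z+a},\qquad a=\cot\tfrac{\pi}{4g},\quad b_j=e^{ij\pi/(2g)}\sqrt{\cot^2\tfrac{\pi}{4g}-1},$$ which maps $s_{j+2g}$ to $s_j$, and let $\Gamma_g$ be the group generated by $f_0,\dots,f_{4g-1}$ and $\mathbb M_g=\mathbb D/\Gamma_g$ the generalized Bolza surface of genus $g$. Let $\operatorname{sys}(\mathbb M_g)$ be its systole, i.e. the infimum of the lengths of the non-contractible closed curves on $\mathbb M_g$; in terms of lifts to $\mathbb D$, $\operatorname{sys}(\mathbb M_g)=\inf\{d(z,f(z)) : z\in\mathbb D,\ f\in\Gamma_g\setminus\{1\}\}$. Let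 $\mathcal N=\{f\in\Gamma_g : f(D_g)\cap D_g\ne\emptyset\}$ and $D_{\mathcal N}=\bigcup_{f\in\mathcal N}f(D_g)$. The original domain $\widetilde D_g\subset D_g$ consists of the interior of $D_g$, the vertex $v_0$, and the sides $s_{2g},\dots,s_{4g-1}$ without their endpoints. A hyperbolic triangle in $\mathbb D$ (the closed region, i.e. the geodesically convex hull of its three vertices) is called admissible if its vertices lie on a hyperbolic circle whose diameter is less than $\tfrac12\operatorname{sys}(\mathbb M_g)$. Then: 1. (Inclusion property) If at least one vertex of an admissible triangle lies in $\widetilde D_g$, then the whole triangle is contained in $D_{\mathcal N}$. 2. For all $p\in\partial D_g$ and $q\in\partial D_{\mathcal N}$ one has $d(p,q)\ge\tfrac12\operatorname{sys}(\mathbb M_g)$. -/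

import Mathlib

open scoped Complex.UnitDisc ComplexConjugate

noncomputable section

namespace GenBolza

/-- The hyperbolic distance (curvature `-1`) on the Poincaré disk. -/
def hdist (z w : 𝔻) : ℝ :=
  2 * Real.arsinh (‖(z : ℂ) - w‖ / Real.sqrt ((1 - ‖(z : ℂ)‖ ^ 2) * (1 - ‖(w : ℂ)‖ ^ 2)))

/-- The geodesic segment between two points of the hyperbolic plane. -/
def hsegment (z w : 𝔻) : Set 𝔻 := {x | hdist z x + hdist x w = hdist z w}

/-- Geodesic convexity. -/
def HConvex (s : Set 𝔻) : Prop := ∀ z ∈ s, ∀ w ∈ s, hsegment z w ⊆ s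

/-- The hyperbolic convex hull. -/
def hhull (s : Set 𝔻) : Set 𝔻 := ⋂₀ {t | s ⊆ t ∧ HConvex t}

/-- The (full, closed) hyperbolic triangle with vertices `a`, `b`, `c`. -/
def triangle (a b c : 𝔻) : Set 𝔻 := hhull {a, b, c}

theorem normSq_identity (a b z : ℂ) :
    ‖conj b * z + conj a‖ ^ 2 - ‖a * z + b‖ ^ 2
      = (‖a‖ ^ 2 - ‖b‖ ^ 2) * (1 - ‖z‖ ^ 2) := by
  simp only [← Complex.normSq_eq_norm_sq, Complex.normSq_apply, Complex.add_re, Complex.add_im,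
    Complex.mul_re, Complex.mul_im, Complex.conj_re, Complex.conj_im]
  ring

theorem norm_num_lt_norm_den {a b : ℂ} (h : ‖a‖ ^ 2 - ‖b‖ ^ 2 = 1) (z : 𝔻) :
    ‖a * (z : ℂ) + b‖ < ‖conj b * (z : ℂ) + conj a‖ := by
  have h1 := normSq_identity a b z
  rw [h, one_mul] at h1
  have h2 := z.sq_norm_lt_one
  exact lt_of_pow_lt_pow_left₀ 2 (norm_nonneg _) (by linarith)

theorem den_ne_zero {a b : ℂ} (h : ‖a‖ ^ 2 - ‖b‖ ^ 2 = 1) (z : 𝔻) :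
    conj b * (z : ℂ) + conj a ≠ 0 :=
  norm_pos_iff.mp (lt_of_le_of_lt (norm_nonneg _) (norm_num_lt_norm_den h z))

/-- The map `z ↦ (a z + b) / (conj b * z + conj a)` of the disk, for `|a|² - |b|² = 1`. -/
def mobiusFun (a b : ℂ) (h : ‖a‖ ^ 2 - ‖b‖ ^ 2 = 1) (z : 𝔻) : 𝔻 :=
  Complex.UnitDisc.mk ((a * (z : ℂ) + b) / (conj b * (z : ℂ) + conj a)) (by
    rw [norm_div, div_lt_one (norm_pos_iff.mpr (den_ne_zero h z))]
    exact norm_num_lt_norm_den h z)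

theorem mobiusFun_inverse {a b a' b' : ℂ} (h : ‖a‖ ^ 2 - ‖b‖ ^ 2 = 1)
    (h' : ‖a'‖ ^ 2 - ‖b'‖ ^ 2 = 1) (ha : a' = conj a) (hb : b' = -b) (z : 𝔻) :
    mobiusFun a' b' h' (mobiusFun a b h z) = z := by
  apply Complex.UnitDisc.coe_injective
  have hd := den_ne_zero h z
  have hd' := den_ne_zero h' (mobiusFun a b h z)
  subst ha hb
  simp only [mobiusFun, Complex.UnitDisc.coe_mk, map_neg, Complex.conj_conj] at hd hd' ⊢
  rw [div_eq_iff hd']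
  have hw := div_mul_cancel₀ (a * (z : ℂ) + b) hd
  linear_combination hw

/-- The orientation preserving isometry `z ↦ (a z + b) / (conj b * z + conj a)` of the hyperbolic
plane, where `|a|² - |b|² = 1` (the identity if this condition fails). -/
def diskIsometry (a b : ℂ) : Equiv.Perm 𝔻 :=
  open scoped Classical in
  if h : ‖a‖ ^ 2 - ‖b‖ ^ 2 = 1 then
    { toFun := mobiusFun a b h
      invFun := mobiusFun (conj a) (-b) (by simpa using h)
      left_inv := fun z => mobiusFun_inverse h _ rfl rfl z
      right_inv := fun z => mobiusFun_inverse _ h (by simp) (by simp) z }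
  else 1

/-- The upper left entry `cot (π / 4g)` of the matrix of each side pairing. -/
def coeffA (g : ℕ) : ℂ := (Real.cot (Real.pi / (4 * g)) : ℝ)

/-- The upper right entry `exp (i j π / 2g) * √(cot² (π / 4g) - 1)` of the matrix of the
`j`-th side pairing. -/
def coeffB (g j : ℕ) : ℂ :=
  Complex.exp (Complex.I * ((j * Real.pi / (2 * g) : ℝ) : ℂ)) *
    (Real.sqrt (Real.cot (Real.pi / (4 * g)) ^ 2 - 1) : ℝ)

theorem coeff_condition {g : ℕ} (hg : 2 ≤ g) (j : ℕ) :
    ‖coeffA g‖ ^ 2 - ‖coeffB g j‖ ^ 2 = 1 := by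
  have hcot : 1 ≤ Real.cot (Real.pi / (4 * g)) := by
    have hg' : (2 : ℝ) ≤ g := by exact_mod_cast hg
    have hpos : 0 < Real.pi / (4 * g) := by positivity
    have hle : Real.pi / (4 * g) ≤ Real.pi / 4 := by
      apply div_le_div_of_nonneg_left Real.pi_pos.le (by norm_num)
      linarith
    have hs : 0 < Real.sin (Real.pi / (4 * g)) :=
      Real.sin_pos_of_pos_of_lt_pi hpos (by linarith [Real.pi_pos])
    rw [Real.cot_eq_cos_div_sin, one_le_div hs]
    calc Real.sin (Real.pi / (4 * g)) ≤ Real.sin (Real.pi / 4) :=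
          Real.sin_le_sin_of_le_of_le_pi_div_two (by linarith [Real.pi_pos])
            (by linarith [Real.pi_pos]) hle
      _ = Real.cos (Real.pi / 4) := by rw [Real.sin_pi_div_four, Real.cos_pi_div_four]
      _ ≤ Real.cos (Real.pi / (4 * g)) :=
          Real.cos_le_cos_of_nonneg_of_le_pi hpos.le (by linarith [Real.pi_pos]) hle
  have hexp : ‖Complex.exp (Complex.I * ((j * Real.pi / (2 * g) : ℝ) : ℂ))‖ = 1 := by
    rw [mul_comm]
    exact Complex.norm_exp_ofReal_mul_I _
  unfold coeffA coeffB
  rw [norm_mul, hexp, one_mul, Complex.norm_real, Complex.norm_real, Real.norm_eq_abs,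
    Real.norm_eq_abs, sq_abs, sq_abs, Real.sq_sqrt (by nlinarith)]
  ring

/-- The side pairing `f_j`, mapping the side `s_{j + 2g}` of the polygon to `s_j`. -/
def sidePairing (g j : ℕ) : Equiv.Perm 𝔻 := diskIsometry (coeffA g) (coeffB g j)

theorem coe_sidePairing {g : ℕ} (hg : 2 ≤ g) (j : ℕ) (z : 𝔻) :
    (sidePairing g j z : ℂ) =
      (coeffA g * z + coeffB g j) / (conj (coeffB g j) * z + conj (coeffA g)) := by
  unfold sidePairing diskIsometry
  rw [dif_pos (coeff_condition hg j)]
  rfl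

/-- The generalized Bolza group `Γ_g`. -/
def group (g : ℕ) : Subgroup (Equiv.Perm 𝔻) :=
  Subgroup.closure {f | ∃ j < 4 * g, f = sidePairing g j}

/-- The Euclidean representation of the vertex `v_k`. The modulus `√(cos (π / 2g))` is the one for
which `v_k` is at hyperbolic distance `arcosh (cot² (π / 4g))` from the origin, that is, for which
the regular `4g`-gon has interior angles `2π / 4g`. -/
def vertexCoe (g k : ℕ) : ℂ :=
  (Real.sqrt (Real.cos (Real.pi / (2 * g))) : ℝ) *
    Complex.exp (Complex.I * (((2 * k - 1) * Real.pi / (4 * g) : ℝ) : ℂ))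

theorem norm_vertexCoe_lt_one {g : ℕ} (hg : 2 ≤ g) (k : ℕ) : ‖vertexCoe g k‖ < 1 := by
  have hexp : ‖Complex.exp (Complex.I * (((2 * k - 1) * Real.pi / (4 * g) : ℝ) : ℂ))‖ = 1 := by
    rw [mul_comm]
    exact Complex.norm_exp_ofReal_mul_I _
  unfold vertexCoe
  rw [norm_mul, hexp, mul_one, Complex.norm_real, Real.norm_eq_abs, abs_of_nonneg (Real.sqrt_nonneg _),
    Real.sqrt_lt' one_pos, one_pow]
  have hg' : (2 : ℝ) ≤ g := by exact_mod_cast hg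
  have hpos : 0 < Real.pi / (2 * g) := by positivity
  have hle : Real.pi / (2 * g) ≤ Real.pi := by
    apply div_le_self Real.pi_pos.le
    linarith
  calc Real.cos (Real.pi / (2 * g)) < Real.cos 0 :=
        Real.cos_lt_cos_of_nonneg_of_le_pi le_rfl hle hpos
    _ = 1 := Real.cos_zero

/-- The vertex `v_k` of the polygon `D_g` (`2 ≤ g`); indices count modulo `4g`, and the midpoint of
the side from `v_0` to `v_1` lies on the positive real axis. -/
def vertex (g k : ℕ) : 𝔻 :=
  open scoped Classical in
  if h : ‖vertexCoe g k‖ < 1 then Complex.UnitDisc.mk (vertexCoe g k) h else 0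

theorem coe_vertex {g : ℕ} (hg : 2 ≤ g) (k : ℕ) : (vertex g k : ℂ) = vertexCoe g k := by
  unfold vertex
  rw [dif_pos (norm_vertexCoe_lt_one hg k)]
  rfl

/-- The side `s_j` of the polygon `D_g`. -/
def side (g j : ℕ) : Set 𝔻 := hsegment (vertex g j) (vertex g (j + 1))

/-- The (closed) regular hyperbolic `4g`-gon `D_g` with angle sum `2π`, centered at the origin. -/
def polygon (g : ℕ) : Set 𝔻 := hhull (Set.range (vertex g))

/-- The original domain: the interior of `D_g`, the vertex `v_0`, and the sides
`s_{2g}, …, s_{4g-1}` without their endpoints. -/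
def originalDomain (g : ℕ) : Set 𝔻 :=
  interior (polygon g) ∪ {vertex g 0} ∪
    ⋃ j ∈ Set.Ico (2 * g) (4 * g), side g j \ Set.range (vertex g)

/-- The set `N` of neighboring translations. -/
def neighbors (g : ℕ) : Set (Equiv.Perm 𝔻) :=
  {f | f ∈ group g ∧ ((f '' polygon g) ∩ polygon g).Nonempty}

/-- The union `D_N` of the neighboring regions of `D_g`. -/
def neighborhoodDomain (g : ℕ) : Set 𝔻 := ⋃ f ∈ neighbors g, f '' polygon g

/-- The systole of the surface `𝔻 / Γ_g`. The non-contractible closed curves on `𝔻 / Γ_g` are the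
projections of the paths in `𝔻` from a point `z` to `f z` with `f ∈ Γ_g`, `f ≠ 1`, and a shortest
such path for given `z` and `f` is the geodesic segment, of length `d(z, f z)`. -/
def systole (g : ℕ) : ℝ :=
  sInf {L : ℝ | ∃ f ∈ group g, f ≠ 1 ∧ ∃ z : 𝔻, L = hdist z (f z)}

/-- `a`, `b`, `c` lie on a hyperbolic circle of diameter less than half the systole. -/
def IsAdmissible (g : ℕ) (a b c : 𝔻) : Prop :=
  ∃ (o : 𝔻) (R : ℝ), hdist o a = R ∧ hdist o b = R ∧ hdist o c = R ∧ 2 * R < systole g / 2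

end GenBolza

end

/-! Write c = cos(π/2g). Both claims follow from one fact: every point at distance less than sys/2
from a point of `polygon g` lies in `neighborhoodDomain g`. For the first claim, a circumscribed
ball is convex and has diameter below sys/2, so it contains the triangle and all of the triangle is
within sys/2 of the vertex lying in the polygon. For the second, a shorter distance would make q an
interior point of the neighborhood.

The number that links the two sides of the fact is arcosh(1 + 2c). It bounds sys/2 from above
(`exists_systole_le`): the midpoints of two neighboring sides are at that distance, and a product of
two side pairings moves one of them by at most twice as much. No lower bound for the systole is
needed. It is also small enough that a segment shorter than it, starting in the polygon, cannot
escape the neighborhood (`mem_neighborhoodDomain_of_mink_lt`).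

For the latter, follow the segment through successive copies of the polygon, always pulling back to
the polygon by the side pairing just used. Two nonadjacent sides are at distance at least arcosh(1 +
2c) (`le_mink_of_nonadjacent`), so each crossing must leave through a side adjacent to the side of
entry. Adjacent on alternating sides is excluded as well (`le_mink_of_zigzag`), so the segment keeps
turning about a single vertex, which belongs to the original polygon; every region met is then a
neighbor. The process stops because a geodesic cannot turn by more than π about a point
(`mem_of_turning`).

All geometry takes place on the hyperboloid in a space of signature (1, 2), where segments are
cones, sides are kernels of linear functionals, and the pairings are Lorentz boosts. -/

noncomputable section

namespace GenBolza

/-! ### The hyperboloid model -/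

/-- The time coordinate of a point of the disk in the hyperboloid model. -/
def hT (z : 𝔻) : ℝ := (1 + Complex.normSq z) / (1 - Complex.normSq z)

/-- The first space coordinate of a point of the disk in the hyperboloid model. -/
def hU (z : 𝔻) : ℝ := 2 * (z : ℂ).re / (1 - Complex.normSq z)

/-- The second space coordinate of a point of the disk in the hyperboloid model. -/
def hV (z : 𝔻) : ℝ := 2 * (z : ℂ).im / (1 - Complex.normSq z)

/-- The Minkowski product of two points of the disk in the hyperboloid model. -/
def mink (z w : 𝔻) : ℝ := hT z * hT w - hU z * hU w - hV z * hV w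

theorem one_sub_normSq_pos (z : 𝔻) : 0 < 1 - Complex.normSq z := by
  linarith [z.normSq_lt_one]

theorem hyperboloid_eq (z : 𝔻) : hT z ^ 2 - hU z ^ 2 - hV z ^ 2 = 1 := by
  have h := (one_sub_normSq_pos z).ne'
  unfold hT hU hV
  field_simp
  rw [Complex.normSq_apply]
  ring

theorem hT_pos (z : 𝔻) : 0 < hT z :=
  div_pos (by linarith [Complex.normSq_nonneg z]) (one_sub_normSq_pos z)

/-- Stereographic projection (u, v) / (1 + t) inverts the passage to the hyperboloid. -/
theorem exists_hyperboloid_coord {t u v : ℝ} (ht : 0 < t) (h : t ^ 2 - u ^ 2 - v ^ 2 = 1) :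
    ∃ z : 𝔻, hT z = t ∧ hU z = u ∧ hV z = v := by
  have h1 : (1 + t) ≠ 0 := by positivity
  have hn : Complex.normSq (⟨u / (1 + t), v / (1 + t)⟩ : ℂ) = (t - 1) / (t + 1) := by
    rw [Complex.normSq_apply]
    have h2 : (t + 1) ≠ 0 := by positivity
    field_simp
    linear_combination (-t - 1) * h
  have hlt : ‖(⟨u / (1 + t), v / (1 + t)⟩ : ℂ)‖ < 1 := by
    rw [← sq_lt_one_iff₀ (norm_nonneg _), ← Complex.normSq_eq_norm_sq, hn, div_lt_one (by positivity)]
    linarith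
  have h3 : 1 - (t - 1) / (t + 1) = 2 / (t + 1) := by
    field_simp; ring
  have h4 : (t + 1) ≠ 0 := by positivity
  refine ⟨Complex.UnitDisc.mk _ hlt, ?_, ?_, ?_⟩
  · rw [hT, Complex.UnitDisc.coe_mk, hn, h3]
    field_simp; ring
  · rw [hU, Complex.UnitDisc.coe_mk, hn, h3]
    field_simp; ring
  · rw [hV, Complex.UnitDisc.coe_mk, hn, h3]
    field_simp; ring

theorem eq_of_hyperboloid_coord {z w : 𝔻} (ht : hT z = hT w) (hu : hU z = hU w)
    (hv : hV z = hV w) : z = w := by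
  have key : ∀ x : 𝔻, (x : ℂ) = ⟨hU x / (1 + hT x), hV x / (1 + hT x)⟩ := by
    intro x
    have h := (one_sub_normSq_pos x).ne'
    have h1 : 1 + hT x = 2 / (1 - Complex.normSq x) := by
      unfold hT
      field_simp; ring
    rw [h1]
    apply Complex.ext
    · simp only [hU]
      field_simp
    · simp only [hV]
      field_simp
  apply Complex.UnitDisc.coe_injective
  rw [key z, key w, ht, hu, hv]

/-! ### The distance as a Minkowski product; metric axioms. -/

theorem hdist_nonneg (z w : 𝔻) : 0 ≤ hdist z w := by
  unfold hdist
  have : 0 ≤ Real.arsinh (‖(z : ℂ) - w‖ / Real.sqrt ((1 - ‖(z : ℂ)‖ ^ 2) * (1 - ‖(w : ℂ)‖ ^ 2))) :=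
    Real.arsinh_nonneg_iff.mpr (by positivity)
  linarith

theorem cosh_hdist (z w : 𝔻) : Real.cosh (hdist z w) = mink z w := by
  have hz := one_sub_normSq_pos z
  have hw := one_sub_normSq_pos w
  rw [hdist, Real.cosh_two_mul, Real.cosh_sq, Real.sinh_arsinh, div_pow, Real.sq_sqrt
    (by rw [← Complex.normSq_eq_norm_sq, ← Complex.normSq_eq_norm_sq]; positivity)]
  simp only [← Complex.normSq_eq_norm_sq]
  unfold mink hT hU hV
  field_simp
  simp only [Complex.normSq_apply, Complex.sub_re, Complex.sub_im]
  ring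

theorem mink_comm (z w : 𝔻) : mink z w = mink w z := by
  unfold mink; ring

theorem one_le_mink (z w : 𝔻) : 1 ≤ mink z w := by
  rw [← cosh_hdist]; exact Real.one_le_cosh _

theorem hdist_comm (z w : 𝔻) : hdist z w = hdist w z := by
  unfold hdist
  rw [norm_sub_rev, mul_comm (1 - ‖(z : ℂ)‖ ^ 2)]

theorem hdist_le_iff {z w : 𝔻} {r : ℝ} (hr : 0 ≤ r) : hdist z w ≤ r ↔ mink z w ≤ Real.cosh r := by
  rw [← cosh_hdist, Real.cosh_le_cosh, abs_of_nonneg (hdist_nonneg z w), abs_of_nonneg hr]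

theorem hdist_eq_of_mink_eq {z w z' w' : 𝔻} (h : mink z w = mink z' w') :
    hdist z w = hdist z' w' := by
  apply le_antisymm
  · rw [hdist_le_iff (hdist_nonneg _ _), cosh_hdist, h]
  · rw [hdist_le_iff (hdist_nonneg _ _), cosh_hdist, h]

/-- The Gram determinant of three vectors of signature `(1, 2)` is a square. -/
theorem gram_det_eq_sq (a₀ a₁ a₂ b₀ b₁ b₂ c₀ c₁ c₂ aa bb cc ab ac bc : ℝ)
    (haa : aa = a₀ ^ 2 - a₁ ^ 2 - a₂ ^ 2) (hbb : bb = b₀ ^ 2 - b₁ ^ 2 - b₂ ^ 2)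
    (hcc : cc = c₀ ^ 2 - c₁ ^ 2 - c₂ ^ 2) (hab : ab = a₀ * b₀ - a₁ * b₁ - a₂ * b₂)
    (hac : ac = a₀ * c₀ - a₁ * c₁ - a₂ * c₂) (hbc : bc = b₀ * c₀ - b₁ * c₁ - b₂ * c₂) :
    aa * bb * cc + 2 * ab * bc * ac - aa * bc ^ 2 - bb * ac ^ 2 - cc * ab ^ 2 =
      (a₀ * (b₁ * c₂ - b₂ * c₁) - a₁ * (b₀ * c₂ - b₂ * c₀) + a₂ * (b₀ * c₁ - b₁ * c₀)) ^ 2 := by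
  subst haa hbb hcc hab hac hbc
  ring

theorem mink_gram_nonneg (a b c : 𝔻) :
    0 ≤ 1 + 2 * mink a b * mink b c * mink a c - mink b c ^ 2 - mink a c ^ 2 - mink a b ^ 2 := by
  have h := gram_det_eq_sq (hT a) (hU a) (hV a) (hT b) (hU b) (hV b) (hT c) (hU c) (hV c)
    1 1 1 (mink a b) (mink a c) (mink b c) (hyperboloid_eq a).symm (hyperboloid_eq b).symm
    (hyperboloid_eq c).symm rfl rfl rfl
  nlinarith [h, sq_nonneg (hT a * (hU b * hV c - hV b * hU c) - hU a * (hT b * hV c - hV b * hT c)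
    + hV a * (hT b * hU c - hU b * hT c))]

theorem sinh_hdist_nonneg (z w : 𝔻) : 0 ≤ Real.sinh (hdist z w) :=
  Real.sinh_nonneg_iff.mpr (hdist_nonneg z w)

theorem sinh_sq_hdist (z w : 𝔻) : Real.sinh (hdist z w) ^ 2 = mink z w ^ 2 - 1 := by
  rw [← cosh_hdist, Real.cosh_sq]; ring

/-- Nonnegativity of the Gram determinant is exactly (cosh ac − cosh ab cosh bc)² ≤ sinh² ab sinh²
bc, which the addition formula for cosh turns into the triangle inequality. -/
theorem hdist_triangle (a b c : 𝔻) : hdist a c ≤ hdist a b + hdist b c := by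
  rw [hdist_le_iff (add_nonneg (hdist_nonneg _ _) (hdist_nonneg _ _)), Real.cosh_add,
    cosh_hdist, cosh_hdist]
  have h := mink_gram_nonneg a b c
  have h1 := sinh_sq_hdist a b
  have h2 := sinh_sq_hdist b c
  have h3 : mink a c - mink a b * mink b c ≤ Real.sinh (hdist a b) * Real.sinh (hdist b c) := by
    apply le_of_sq_le_sq _ (mul_nonneg (sinh_hdist_nonneg _ _) (sinh_hdist_nonneg _ _))
    rw [mul_pow, h1, h2]
    linarith
  linarith

theorem eq_of_hdist_eq_zero {z w : 𝔻} (h : hdist z w = 0) : z = w := by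
  unfold hdist at h
  have h1 : ‖(z : ℂ) - w‖ / Real.sqrt ((1 - ‖(z : ℂ)‖ ^ 2) * (1 - ‖(w : ℂ)‖ ^ 2)) = 0 := by
    rw [← Real.arsinh_eq_zero_iff]; linarith
  have h2 : 0 < Real.sqrt ((1 - ‖(z : ℂ)‖ ^ 2) * (1 - ‖(w : ℂ)‖ ^ 2)) := by
    apply Real.sqrt_pos.mpr
    exact mul_pos (by linarith [z.sq_norm_lt_one]) (by linarith [w.sq_norm_lt_one])
  rw [div_eq_zero_iff, or_iff_left h2.ne', norm_eq_zero, sub_eq_zero] at h1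
  exact Complex.UnitDisc.coe_injective h1

theorem continuous_hdist_right (z : 𝔻) : Continuous (hdist z) := by
  unfold hdist
  have hpos : ∀ w : 𝔻, Real.sqrt ((1 - ‖(z : ℂ)‖ ^ 2) * (1 - ‖(w : ℂ)‖ ^ 2)) ≠ 0 := fun w =>
    (Real.sqrt_pos.mpr (mul_pos (by linarith [z.sq_norm_lt_one])
      (by linarith [w.sq_norm_lt_one]))).ne'
  have hc := Complex.UnitDisc.continuous_coe
  refine continuous_const.mul (Real.continuous_arsinh.comp ?_)
  exact Continuous.div (by fun_prop) (by fun_prop) hpos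

/-! ### Segments as cones, and convexity. -/

/-- `x` is a nonnegative linear combination of `z` and `w` in the hyperboloid model. -/
def IsComb (α β : ℝ) (z w x : 𝔻) : Prop :=
  hT x = α * hT z + β * hT w ∧ hU x = α * hU z + β * hU w ∧ hV x = α * hV z + β * hV w

theorem IsComb.norm_eq {α β : ℝ} {z w x : 𝔻} (h : IsComb α β z w x) :
    α ^ 2 + β ^ 2 + 2 * α * β * mink z w = 1 := by
  obtain ⟨h0, h1, h2⟩ := h
  rw [← hyperboloid_eq x, h0, h1, h2]
  have hz := hyperboloid_eq z
  have hw := hyperboloid_eq w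
  unfold mink
  linear_combination (-α ^ 2) * hz - β ^ 2 * hw

/-- The coefficients are ratios of hyperbolic sines: sinh d(z,x) = β sinh d(z,w) and sinh d(x,w) = α
sinh d(z,w). The addition formula for cosh then makes the distances add up. -/
theorem IsComb.mem_hsegment {α β : ℝ} {z w x : 𝔻} (hα : 0 ≤ α) (hβ : 0 ≤ β)
    (h : IsComb α β z w x) : x ∈ hsegment z w := by
  have hn := h.norm_eq
  obtain ⟨h0, h1, h2⟩ := h
  have hz := hyperboloid_eq z
  have hw := hyperboloid_eq w
  have hp : mink z x = α + β * mink z w := by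
    unfold mink; rw [h0, h1, h2]; linear_combination α * hz
  have hq : mink x w = α * mink z w + β := by
    unfold mink; rw [h0, h1, h2]; linear_combination β * hw
  have hr := sinh_sq_hdist z w
  have hs1 : Real.sinh (hdist z x) = β * Real.sinh (hdist z w) := by
    rw [← sq_eq_sq₀ (sinh_hdist_nonneg _ _) (mul_nonneg hβ (sinh_hdist_nonneg _ _)), mul_pow,
      sinh_sq_hdist, hr, hp]
    linear_combination hn
  have hs2 : Real.sinh (hdist x w) = α * Real.sinh (hdist z w) := by
    rw [← sq_eq_sq₀ (sinh_hdist_nonneg _ _) (mul_nonneg hα (sinh_hdist_nonneg _ _)), mul_pow,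
      sinh_sq_hdist, hr, hq]
    linear_combination hn
  have hc : Real.cosh (hdist z x + hdist x w) = Real.cosh (hdist z w) := by
    rw [Real.cosh_add, cosh_hdist, cosh_hdist, cosh_hdist, hs1, hs2, hp, hq]
    linear_combination (α * β) * hr + mink z w * hn
  have := abs_eq_abs.mp (show |hdist z x + hdist x w| = |hdist z w| from
    le_antisymm (Real.cosh_le_cosh.mp hc.le) (Real.cosh_le_cosh.mp hc.ge))
  change hdist z x + hdist x w = hdist z w
  have a1 := hdist_nonneg z x
  have a2 := hdist_nonneg x w
  have a3 := hdist_nonneg z w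
  rcases this with h | h <;> linarith

/-- A vector orthogonal to a timelike vector with nonnegative square vanishes. -/
theorem eq_zero_of_orthogonal {a₀ a₁ a₂ d₀ d₁ d₂ : ℝ} (ha : a₀ ^ 2 - a₁ ^ 2 - a₂ ^ 2 = 1)
    (h : d₀ * a₀ - d₁ * a₁ - d₂ * a₂ = 0) (hd : 0 ≤ d₀ ^ 2 - d₁ ^ 2 - d₂ ^ 2) :
    d₀ = 0 ∧ d₁ = 0 ∧ d₂ = 0 := by
  have h1 : (d₀ * a₀) ^ 2 ≤ (d₁ ^ 2 + d₂ ^ 2) * (a₁ ^ 2 + a₂ ^ 2) := by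
    rw [show d₀ * a₀ = d₁ * a₁ + d₂ * a₂ by linarith]
    nlinarith [sq_nonneg (d₁ * a₂ - d₂ * a₁)]
  have h2 : d₁ ^ 2 + d₂ ^ 2 ≤ 0 := by
    nlinarith [mul_nonneg hd (sq_nonneg a₀)]
  have h3 : d₁ = 0 := by nlinarith [sq_nonneg d₁, sq_nonneg d₂]
  have h4 : d₂ = 0 := by nlinarith [sq_nonneg d₁, sq_nonneg d₂]
  subst h3 h4
  have h5 : a₀ ≠ 0 := by rintro rfl; nlinarith [sq_nonneg a₁, sq_nonneg a₂]
  refine ⟨?_, rfl, rfl⟩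
  simpa [h5] using h

/-- With the sine ratios as coefficients, the vector x − αz − βw is orthogonal to z, w and x by the
subtraction and addition formulas. It is therefore null and orthogonal to the timelike z, so it
vanishes. -/
theorem exists_isComb_of_mem_hsegment {z w x : 𝔻} (hx : x ∈ hsegment z w) :
    ∃ α β : ℝ, 0 ≤ α ∧ 0 ≤ β ∧ IsComb α β z w x := by
  have hx' : hdist z x + hdist x w = hdist z w := hx
  rcases (hdist_nonneg z w).eq_or_lt' with h0 | h0
  · have hzx : z = x := eq_of_hdist_eq_zero (by linarith [hdist_nonneg z x, hdist_nonneg x w])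
    subst hzx
    exact ⟨1, 0, zero_le_one, le_rfl, by simp [IsComb]⟩
  have hs : 0 < Real.sinh (hdist z w) := Real.sinh_pos_iff.mpr h0
  refine ⟨Real.sinh (hdist x w) / Real.sinh (hdist z w),
    Real.sinh (hdist z x) / Real.sinh (hdist z w), div_nonneg (sinh_hdist_nonneg _ _) hs.le,
    div_nonneg (sinh_hdist_nonneg _ _) hs.le, ?_⟩
  set α := Real.sinh (hdist x w) / Real.sinh (hdist z w) with hα
  set β := Real.sinh (hdist z x) / Real.sinh (hdist z w) with hβ
  have e1 : hdist x w = hdist z w - hdist z x := by linarith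
  have e2 : hdist z x = hdist z w - hdist x w := by linarith
  have hA : mink x z - α - β * mink z w = 0 := by
    rw [hα, hβ, mink_comm x z, ← cosh_hdist, ← cosh_hdist, e1, Real.sinh_sub]
    field_simp
    ring
  have hB : mink x w - α * mink z w - β = 0 := by
    rw [hα, hβ, ← cosh_hdist, ← cosh_hdist, e2, Real.sinh_sub]
    field_simp
    ring
  have hC : 1 - α * mink x z - β * mink x w = 0 := by
    have := congrArg Real.sinh hx'
    rw [Real.sinh_add] at this
    rw [hα, hβ, mink_comm x z, ← cosh_hdist, ← cosh_hdist]
    field_simp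
    linarith
  have hz := hyperboloid_eq z
  have hw := hyperboloid_eq w
  have hxx := hyperboloid_eq x
  unfold mink at hA hB hC
  obtain ⟨k0, k1, k2⟩ := eq_zero_of_orthogonal (d₀ := hT x - α * hT z - β * hT w)
    (d₁ := hU x - α * hU z - β * hU w) (d₂ := hV x - α * hV z - β * hV w) hz
    (by linear_combination hA - α * hz)
    (le_of_eq (by linear_combination (-1) * hxx - hC + α * hA + β * hB - α ^ 2 * hz - β ^ 2 * hw))
  exact ⟨by linarith, by linarith, by linarith⟩

/-- The central projection of a nonnegative combination to the hyperboloid. -/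
theorem exists_isComb_smul (z w : 𝔻) {α β : ℝ} (hα : 0 ≤ α) (hβ : 0 ≤ β) (h : 0 < α + β) :
    ∃ x : 𝔻, ∃ r : ℝ, 0 < r ∧ IsComb (r * α) (r * β) z w x := by
  have hz := hyperboloid_eq z
  have hw := hyperboloid_eq w
  have hN : 0 < α ^ 2 + β ^ 2 + 2 * α * β * mink z w := by
    nlinarith [one_le_mink z w, mul_nonneg hα hβ, mul_pos h h]
  set N := α ^ 2 + β ^ 2 + 2 * α * β * mink z w with hNdef
  have hs := Real.sqrt_pos.mpr hN
  have hs2 : (Real.sqrt N)⁻¹ ^ 2 * N = 1 := by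
    rw [inv_pow, Real.sq_sqrt hN.le, inv_mul_cancel₀ hN.ne']
  set r := (Real.sqrt N)⁻¹ with hr
  have hrpos : 0 < r := inv_pos.mpr hs
  have htz := hT_pos z
  have htw := hT_pos w
  obtain ⟨x, h0, h1, h2⟩ := exists_hyperboloid_coord (t := r * α * hT z + r * β * hT w)
    (u := r * α * hU z + r * β * hU w) (v := r * α * hV z + r * β * hV w)
    (by
      rcases hα.eq_or_lt' with h' | h'
      · have : 0 < β := by linarith
        positivity
      · positivity)
    (by
      rw [hNdef] at hs2
      unfold mink at hs2
      linear_combination hs2 + r ^ 2 * α ^ 2 * hz + r ^ 2 * β ^ 2 * hw)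
  exact ⟨x, r, hrpos, h0, h1, h2⟩

/-- The ball is cut out by the linear condition `mink o x ≤ cosh R`. A point of a segment has
coefficients with α + β ≤ 1, because 1 = α² + β² + 2αβ `mink z w` ≥ (α + β)². -/
theorem hConvex_closedBall (o : 𝔻) {R : ℝ} (hR : 0 ≤ R) : HConvex {x | hdist o x ≤ R} := by
  intro z hz w hw x hx
  obtain ⟨α, β, hα, hβ, h⟩ := exists_isComb_of_mem_hsegment hx
  have hn := h.norm_eq
  obtain ⟨h0, h1, h2⟩ := h
  simp only [Set.mem_ofPred_eq, hdist_le_iff hR] at hz hw ⊢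
  have hx : mink o x = α * mink o z + β * mink o w := by
    unfold mink; rw [h0, h1, h2]; ring
  have hab : α + β ≤ 1 := by
    nlinarith [one_le_mink z w, mul_nonneg hα hβ]
  have hc := Real.cosh_pos R
  rw [hx]
  nlinarith

theorem hhull_subset {s t : Set 𝔻} (h : s ⊆ t) (ht : HConvex t) : hhull s ⊆ t :=
  Set.sInter_subset_of_mem ⟨h, ht⟩

theorem subset_hhull (s : Set 𝔻) : s ⊆ hhull s :=
  Set.subset_sInter fun _ h => h.1

theorem hConvex_hhull (s : Set 𝔻) : HConvex (hhull s) := by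
  intro z hz w hw x hx t ht
  exact ht.2 z (hz t ht) w (hw t ht) hx

theorem hdist_le_of_mem_hsegment_left {z w x : 𝔻} (h : x ∈ hsegment z w) :
    hdist z x ≤ hdist z w := by
  have : hdist z x + hdist x w = hdist z w := h
  linarith [hdist_nonneg x w]

theorem hdist_le_of_mem_hsegment_right {z w x : 𝔻} (h : x ∈ hsegment z w) :
    hdist x w ≤ hdist z w := by
  have : hdist z x + hdist x w = hdist z w := h
  linarith [hdist_nonneg z x]

/-! ### Distance between geodesics in terms of their normals. -/

/-- In a space of signature `(1, 2)`, the square of a vector in terms of two orthonormal ones. -/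
theorem sq_le_of_orthonormal {q₀ q₁ q₂ n₀ n₁ n₂ w₀ w₁ w₂ : ℝ} (hq : q₀ ^ 2 - q₁ ^ 2 - q₂ ^ 2 = 1)
    (hn : n₀ ^ 2 - n₁ ^ 2 - n₂ ^ 2 = -1) (hqn : q₀ * n₀ - q₁ * n₁ - q₂ * n₂ = 0) :
    w₀ ^ 2 - w₁ ^ 2 - w₂ ^ 2 ≤
      (q₀ * w₀ - q₁ * w₁ - q₂ * w₂) ^ 2 - (n₀ * w₀ - n₁ * w₁ - n₂ * w₂) ^ 2 := by
  have h := gram_det_eq_sq q₀ q₁ q₂ n₀ n₁ n₂ w₀ w₁ w₂ _ _ _ _ _ _ hq.symm hn.symm rfl hqn.symm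
    rfl rfl
  nlinarith [h, sq_nonneg (q₀ * (n₁ * w₂ - n₂ * w₁) - q₁ * (n₀ * w₂ - n₂ * w₀)
    + q₂ * (n₀ * w₁ - n₁ * w₀))]

/-- Points on two geodesics are at least as far apart as the geodesics. -/
theorem abs_le_mink_of_orthogonal {p q : 𝔻} {m₀ m₁ m₂ n₀ n₁ n₂ : ℝ}
    (hm : m₀ ^ 2 - m₁ ^ 2 - m₂ ^ 2 = -1) (hn : n₀ ^ 2 - n₁ ^ 2 - n₂ ^ 2 = -1)
    (hp : hT p * m₀ - hU p * m₁ - hV p * m₂ = 0) (hq : hT q * n₀ - hU q * n₁ - hV q * n₂ = 0) :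
    |n₀ * m₀ - n₁ * m₁ - n₂ * m₂| ≤ mink p q := by
  -- Writing · for the Minkowski product, this gives (m·q)² ≤ (p·q)² − 1 and the next line gives
  -- (n·m)² ≤ (q·m)² + 1; adding them yields the claim.
  have h1 := sq_le_of_orthonormal (w₀ := hT q) (w₁ := hU q) (w₂ := hV q) (hyperboloid_eq p) hm hp
  have h2 := sq_le_of_orthonormal (w₀ := m₀) (w₁ := m₁) (w₂ := m₂) (hyperboloid_eq q) hn hq
  have h3 := hyperboloid_eq q
  apply abs_le_of_sq_le_sq _ (by linarith [one_le_mink p q])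
  unfold mink
  nlinarith

/-! ### Trigonometry of the polygon -/

/-- The interior angle of the polygon, which is also the central angle of a side. -/
def ang (g : ℕ) : ℝ := Real.pi / (2 * g)

/-- The hyperbolic cosine of the inradius of the polygon. -/
def cshA (g : ℕ) : ℝ := Real.cot (Real.pi / (4 * g))

/-- The hyperbolic sine of the inradius of the polygon. -/
def snhA (g : ℕ) : ℝ := Real.sqrt (Real.cot (Real.pi / (4 * g)) ^ 2 - 1)

/-- The primitive root of unity whose powers are the directions of the sides. -/
def zeta (g : ℕ) : ℂ := Complex.exp (2 * Real.pi * Complex.I / (4 * g : ℕ))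

section
variable {g : ℕ} (hg : 2 ≤ g)
include hg

theorem ang_pos : 0 < ang g := by
  have hg' : (2 : ℝ) ≤ g := by exact_mod_cast hg
  have := Real.pi_pos
  unfold ang; positivity

theorem ang_le : ang g ≤ Real.pi / 4 := by
  have hg' : (2 : ℝ) ≤ g := by exact_mod_cast hg
  apply div_le_div_of_nonneg_left Real.pi_pos.le (by norm_num)
  linarith

theorem two_mul_ang : 2 * g * ang g = Real.pi := by
  have hg' : (g : ℝ) ≠ 0 := by positivity
  unfold ang; field_simp

theorem ang_half_eq : Real.pi / (4 * g) = ang g / 2 := by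
  have hg' : (g : ℝ) ≠ 0 := by positivity
  unfold ang; field_simp; norm_num

theorem sin_ang_pos : 0 < Real.sin (ang g) :=
  Real.sin_pos_of_pos_of_lt_pi (ang_pos hg) (by linarith [ang_le hg, Real.pi_pos])

theorem sin_half_pos : 0 < Real.sin (ang g / 2) :=
  Real.sin_pos_of_pos_of_lt_pi (by linarith [ang_pos hg]) (by linarith [ang_le hg, Real.pi_pos])

theorem cos_half_pos : 0 < Real.cos (ang g / 2) :=
  Real.cos_pos_of_mem_Ioo ⟨by linarith [ang_pos hg, Real.pi_pos],
    by linarith [ang_le hg, Real.pi_pos]⟩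

theorem cos_ang_pos : 0 < Real.cos (ang g) :=
  Real.cos_pos_of_mem_Ioo ⟨by linarith [ang_pos hg, Real.pi_pos],
    by linarith [ang_le hg, Real.pi_pos]⟩

omit hg in
theorem cos_ang_eq : Real.cos (ang g) = 2 * Real.cos (ang g / 2) ^ 2 - 1 := by
  rw [← Real.cos_two_mul]; ring_nf

theorem cos_ang_lt_one : Real.cos (ang g) < 1 := by
  have h1 := sin_half_pos hg
  have h2 := Real.sin_sq_add_cos_sq (ang g / 2)
  rw [cos_ang_eq]; nlinarith

theorem cshA_mul_sin : cshA g * Real.sin (ang g / 2) = Real.cos (ang g / 2) := by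
  rw [cshA, ang_half_eq hg, Real.cot_eq_cos_div_sin, div_mul_cancel₀ _ (sin_half_pos hg).ne']

theorem cshA_pos : 0 < cshA g := by
  have h := cshA_mul_sin hg
  have h1 := sin_half_pos hg
  have h2 := cos_half_pos hg
  by_contra! h3
  nlinarith

theorem cshA_sq_mul : cshA g ^ 2 * (1 - Real.cos (ang g)) = 1 + Real.cos (ang g) := by
  have h := cshA_mul_sin hg
  have h2 := Real.sin_sq_add_cos_sq (ang g / 2)
  have h3 := congrArg (· ^ 2) h
  simp only [mul_pow] at h3
  rw [cos_ang_eq]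
  linear_combination 2 * h3 - 2 * cshA g ^ 2 * h2

theorem one_lt_cshA_sq : 1 < cshA g ^ 2 := by
  have h1 := cshA_sq_mul hg
  have h2 := cos_ang_pos hg
  have h3 := cos_ang_lt_one hg
  by_contra! h
  nlinarith

theorem snhA_sq : snhA g ^ 2 = cshA g ^ 2 - 1 := by
  have := one_lt_cshA_sq hg
  rw [snhA, Real.sq_sqrt]; · rfl
  unfold cshA at this; linarith

theorem snhA_pos : 0 < snhA g := by
  have := one_lt_cshA_sq hg
  unfold cshA at this
  exact Real.sqrt_pos.mpr (by linarith)

theorem zeta_isPrimitiveRoot : IsPrimitiveRoot (zeta g) (4 * g) :=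
  Complex.isPrimitiveRoot_exp _ (by omega)

theorem zeta_pow_eq (k : ℕ) : zeta g ^ k = Complex.exp ((k * ang g : ℝ) * Complex.I) := by
  have hg' : (g : ℂ) ≠ 0 := by
    have : g ≠ 0 := by omega
    exact_mod_cast this
  rw [zeta, ← Complex.exp_nat_mul, ang]
  congr 1
  push_cast
  field_simp
  norm_num

theorem zeta_pow_re (k : ℕ) : (zeta g ^ k).re = Real.cos (k * ang g) := by
  rw [zeta_pow_eq hg, Complex.exp_ofReal_mul_I_re]

theorem zeta_pow_im (k : ℕ) : (zeta g ^ k).im = Real.sin (k * ang g) := by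
  rw [zeta_pow_eq hg, Complex.exp_ofReal_mul_I_im]

theorem zeta_re : (zeta g).re = Real.cos (ang g) := by
  simpa using zeta_pow_re hg 1

theorem zeta_im : (zeta g).im = Real.sin (ang g) := by
  simpa using zeta_pow_im hg 1

/-- The two bounds say that m is at cyclic distance at least l from 0 modulo 4g; past the half turn,
m is replaced by 4g − m. -/
theorem cos_mul_ang_le {l m : ℕ} (h1 : l ≤ m) (h2 : m + l ≤ 4 * g) :
    Real.cos (m * ang g) ≤ Real.cos (l * ang g) := by
  have hp := two_mul_ang hg
  have ha := ang_pos hg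
  have aux : ∀ n : ℕ, l ≤ n → n ≤ 2 * g → Real.cos (n * ang g) ≤ Real.cos (l * ang g) := by
    intro n hn1 hn2
    have hn1' : (l : ℝ) ≤ n := by exact_mod_cast hn1
    have hn2' : (n : ℝ) ≤ 2 * g := by exact_mod_cast hn2
    apply Real.cos_le_cos_of_nonneg_of_le_pi (by positivity) _ (by gcongr)
    rw [← hp]; gcongr
  rcases le_total m (2 * g) with h | h
  · exact aux m h1 h
  · have e : Real.cos (m * ang g) = Real.cos ((4 * g - m : ℕ) * ang g) := by
      rw [← Real.cos_two_pi_sub, Nat.cast_sub (by omega)]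
      congr 1
      push_cast
      linarith
    rw [e]
    exact aux _ (by omega) (by omega)

/-! ### Directions of the sides -/

omit hg in
theorem normSq_eq_one_of_pow {ω : ℂ} (hg : 2 ≤ g) (h : ω ^ (4 * g) = 1) :
    ω.re ^ 2 + ω.im ^ 2 = 1 := by
  have h1 : ‖ω‖ = 1 := Complex.norm_eq_one_of_pow_eq_one h (by omega)
  have h2 : Complex.normSq ω = 1 := by rw [Complex.normSq_eq_norm_sq, h1, one_pow]
  rw [Complex.normSq_apply] at h2
  linarith

theorem re_le_of_ne_one {ω : ℂ} (h : ω ^ (4 * g) = 1) (h1 : ω ≠ 1) :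
    ω.re ≤ Real.cos (ang g) := by
  have : NeZero (4 * g) := ⟨by omega⟩
  obtain ⟨m, hm, rfl⟩ := (zeta_isPrimitiveRoot hg).eq_pow_of_pow_eq_one h
  rw [zeta_pow_re hg]
  have hm0 : m ≠ 0 := by rintro rfl; simp at h1
  simpa using cos_mul_ang_le hg (l := 1) (m := m) (by omega) (by omega)

theorem conj_zeta : conj (zeta g) = zeta g ^ (4 * g - 1) := by
  have h := (zeta_isPrimitiveRoot hg).pow_eq_one
  have h0 : zeta g ≠ 0 := (zeta_isPrimitiveRoot hg).ne_zero (by omega)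
  have h1 : zeta g * conj (zeta g) = 1 := by
    rw [Complex.mul_conj, Complex.normSq_apply, ← sq, ← sq, normSq_eq_one_of_pow hg h]; simp
  apply mul_left_cancel₀ h0
  rw [h1, ← pow_succ', Nat.sub_add_cancel (by omega), h]

theorem re_le_of_ne {ω : ℂ} (h : ω ^ (4 * g) = 1) (h1 : ω ≠ 1) (h2 : ω ≠ zeta g)
    (h3 : ω ≠ conj (zeta g)) : ω.re ≤ 2 * Real.cos (ang g) ^ 2 - 1 := by
  have : NeZero (4 * g) := ⟨by omega⟩
  rw [conj_zeta hg] at h3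
  obtain ⟨m, hm, rfl⟩ := (zeta_isPrimitiveRoot hg).eq_pow_of_pow_eq_one h
  rw [zeta_pow_re hg, ← Real.cos_two_mul]
  have hm0 : m ≠ 0 := by rintro rfl; simp at h1
  have hm1 : m ≠ 1 := by rintro rfl; simp at h2
  have hm2 : m ≠ 4 * g - 1 := by rintro rfl; exact h3 rfl
  simpa using cos_mul_ang_le hg (l := 2) (m := m) (by omega) (by omega)

end

/-! ### The side pairings in the hyperboloid model -/

/-- The linear functional which vanishes on the side with direction `ω` and is positive beyond
it. -/
def sideFun (g : ℕ) (ω : ℂ) (z : 𝔻) : ℝ := cshA g * (ω.re * hU z + ω.im * hV z) - snhA g * hT z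

/-- The side pairing with direction `ω`. -/
def pairing (g : ℕ) (ω : ℂ) : Equiv.Perm 𝔻 := diskIsometry (coeffA g) (ω * (snhA g : ℝ))

section
variable {g : ℕ} (hg : 2 ≤ g)
include hg

theorem pairing_condition {ω : ℂ} (hω : ω.re ^ 2 + ω.im ^ 2 = 1) :
    ‖coeffA g‖ ^ 2 - ‖ω * (snhA g : ℝ)‖ ^ 2 = 1 := by
  have h := snhA_sq hg
  rw [← Complex.normSq_eq_norm_sq, ← Complex.normSq_eq_norm_sq, Complex.normSq_mul,
    Complex.normSq_apply ω, ← sq, ← sq, hω, coeffA, Complex.normSq_ofReal, Complex.normSq_ofReal]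
  unfold cshA at h
  linarith

theorem coe_pairing {ω : ℂ} (hω : ω.re ^ 2 + ω.im ^ 2 = 1) (z : 𝔻) :
    (pairing g ω z : ℂ) = (cshA g * z + ω * snhA g) / (conj (ω * (snhA g : ℂ)) * z + cshA g) := by
  unfold pairing diskIsometry
  rw [dif_pos (pairing_condition hg hω)]
  change (coeffA g * z + ω * (snhA g : ℝ)) / (conj (ω * (snhA g : ℂ)) * z + conj (coeffA g)) = _
  simp only [coeffA, Complex.conj_ofReal, cshA]

/-- The pairing is the Lorentz boost in direction ω by twice the inradius: `cshA g ^ 2 + snhA g ^ 2`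
and `2 * cshA g * snhA g` are its hyperbolic cosine and sine. -/
theorem pairing_coord {ω : ℂ} (hω : ω.re ^ 2 + ω.im ^ 2 = 1) (z : 𝔻) :
    hT (pairing g ω z) = (cshA g ^ 2 + snhA g ^ 2) * hT z
        + 2 * cshA g * snhA g * (ω.re * hU z + ω.im * hV z) ∧
    hU (pairing g ω z) = hU z + ω.re * (2 * snhA g ^ 2 * (ω.re * hU z + ω.im * hV z)
        + 2 * cshA g * snhA g * hT z) ∧
    hV (pairing g ω z) = hV z + ω.im * (2 * snhA g ^ 2 * (ω.re * hU z + ω.im * hV z)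
        + 2 * cshA g * snhA g * hT z) := by
  have hS := snhA_sq hg
  have hz := one_sub_normSq_pos z
  have hw := coe_pairing hg hω z
  set A := cshA g
  set S := snhA g
  set N : ℂ := A * z + ω * S with hN
  set D : ℂ := conj (ω * (S : ℂ)) * z + A with hD
  have hN' : Complex.normSq N = (A * (z : ℂ).re + ω.re * S) ^ 2 + (A * (z : ℂ).im + ω.im * S) ^ 2 := by
    rw [hN, Complex.normSq_apply]; simp; ring
  have hD' : Complex.normSq D = (S * (ω.re * (z : ℂ).re + ω.im * (z : ℂ).im) + A) ^ 2
      + (S * (ω.re * (z : ℂ).im - ω.im * (z : ℂ).re)) ^ 2 := by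
    rw [hD, Complex.normSq_apply]; simp; ring
  have hND : Complex.normSq D - Complex.normSq N = 1 - Complex.normSq z := by
    rw [hN', hD', Complex.normSq_apply]
    linear_combination (S ^ 2 * ((z : ℂ).re ^ 2 + (z : ℂ).im ^ 2) - S ^ 2) * hω
      + ((z : ℂ).re ^ 2 + (z : ℂ).im ^ 2 - 1) * hS
  have hDpos : 0 < Complex.normSq D := by
    have := Complex.normSq_nonneg N
    linarith
  have hn : Complex.normSq (pairing g ω z) = Complex.normSq N / Complex.normSq D := by
    rw [hw, Complex.normSq_div]
  have hre : (pairing g ω z : ℂ).re = (N * conj D).re / Complex.normSq D := by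
    rw [hw, Complex.div_re]
    simp only [Complex.mul_re, Complex.conj_re, Complex.conj_im]
    ring
  have him : (pairing g ω z : ℂ).im = (N * conj D).im / Complex.normSq D := by
    rw [hw, Complex.div_im]
    simp only [Complex.mul_im, Complex.conj_re, Complex.conj_im]
    ring
  have h1 : 1 - Complex.normSq (pairing g ω z) = (1 - Complex.normSq z) / Complex.normSq D := by
    rw [hn, ← hND]; field_simp
  have hsum : Complex.normSq D + Complex.normSq N = (A ^ 2 + S ^ 2) * (1 + Complex.normSq z)
      + 4 * A * S * (ω.re * (z : ℂ).re + ω.im * (z : ℂ).im) := by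
    rw [hN', hD', Complex.normSq_apply]
    linear_combination (S ^ 2 * ((z : ℂ).re ^ 2 + (z : ℂ).im ^ 2) + S ^ 2) * hω
  have hpre : (N * conj D).re = (z : ℂ).re + ω.re * (2 * S ^ 2 * (ω.re * (z : ℂ).re
      + ω.im * (z : ℂ).im) + A * S * (1 + Complex.normSq z)) := by
    rw [hN, hD, Complex.normSq_apply]
    simp only [map_add, map_mul, Complex.conj_ofReal, Complex.conj_conj, Complex.add_re, Complex.add_im,
      Complex.mul_re, Complex.mul_im, Complex.conj_re, Complex.conj_im, Complex.ofReal_re,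
      Complex.ofReal_im]
    linear_combination (-(z : ℂ).re) * hS - S ^ 2 * (z : ℂ).re * hω
  have hpim : (N * conj D).im = (z : ℂ).im + ω.im * (2 * S ^ 2 * (ω.re * (z : ℂ).re
      + ω.im * (z : ℂ).im) + A * S * (1 + Complex.normSq z)) := by
    rw [hN, hD, Complex.normSq_apply]
    simp only [map_add, map_mul, Complex.conj_ofReal, Complex.conj_conj, Complex.add_re, Complex.add_im,
      Complex.mul_re, Complex.mul_im, Complex.conj_re, Complex.conj_im, Complex.ofReal_re,
      Complex.ofReal_im]
    linear_combination (-(z : ℂ).im) * hS - S ^ 2 * (z : ℂ).im * hω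
  refine ⟨?_, ?_, ?_⟩
  · have e : 1 + Complex.normSq (pairing g ω z) =
        (Complex.normSq D + Complex.normSq N) / Complex.normSq D := by
      rw [hn]; field_simp
    rw [hT, h1, e, hsum]
    unfold hT hU hV
    field_simp
    ring
  · rw [hU, h1, hre, hpre]
    unfold hT hU hV
    field_simp
  · rw [hV, h1, him, hpim]
    unfold hT hU hV
    field_simp

theorem mink_pairing {ω : ℂ} (hω : ω.re ^ 2 + ω.im ^ 2 = 1) (z w : 𝔻) :
    mink (pairing g ω z) (pairing g ω w) = mink z w := by
  obtain ⟨z0, z1, z2⟩ := pairing_coord hg hω z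
  obtain ⟨w0, w1, w2⟩ := pairing_coord hg hω w
  have hS := snhA_sq hg
  unfold mink
  rw [z0, z1, z2, w0, w1, w2]
  generalize cshA g = A at *
  generalize snhA g = S at *
  generalize hU z = u, hV z = v, hT z = t, hU w = u', hV w = v', hT w = t', ω.re = a, ω.im = b at *
  linear_combination (-(2 * S ^ 2 * (a * u + b * v) + 2 * A * S * t)
    * (2 * S ^ 2 * (a * u' + b * v') + 2 * A * S * t')) * hω
    - ((A ^ 2 - S ^ 2 + 1) * t * t' + 2 * A * S * (t * (a * u' + b * v') + (a * u + b * v) * t')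
      + 4 * S ^ 2 * (a * u + b * v) * (a * u' + b * v')) * hS

theorem hdist_pairing {ω : ℂ} (hω : ω.re ^ 2 + ω.im ^ 2 = 1) (z w : 𝔻) :
    hdist (pairing g ω z) (pairing g ω w) = hdist z w :=
  hdist_eq_of_mink_eq (mink_pairing hg hω z w)

theorem pairing_neg_apply {ω : ℂ} (hω : ω.re ^ 2 + ω.im ^ 2 = 1) (z : 𝔻) :
    pairing g ω (pairing g (-ω) z) = z := by
  obtain ⟨z0, z1, z2⟩ := pairing_coord hg (ω := -ω) (by simpa using hω) z
  obtain ⟨w0, w1, w2⟩ := pairing_coord hg hω (pairing g (-ω) z)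
  have hS := snhA_sq hg
  simp only [Complex.neg_re, Complex.neg_im] at z0 z1 z2
  apply eq_of_hyperboloid_coord
  · rw [w0, z0, z1, z2]
    generalize cshA g = A at *
    generalize snhA g = S at *
    generalize hU z = u, hV z = v, hT z = t, ω.re = a, ω.im = b at *
    linear_combination (2 * A * S * (2 * S ^ 2 * (a * u + b * v) - 2 * A * S * t)) * hω
      + (-(A ^ 2 - S ^ 2 + 1) * t + 2 * A * S * (a * u + b * v)) * hS
  · rw [w1, z0, z1, z2]
    generalize cshA g = A at *
    generalize snhA g = S at *
    generalize hU z = u, hV z = v, hT z = t, ω.re = a, ω.im = b at *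
    linear_combination (2 * S ^ 2 * a * (2 * S ^ 2 * (a * u + b * v) - 2 * A * S * t)) * hω
      + a * (4 * S ^ 2 * (a * u + b * v) - 2 * A * S * t) * hS
  · rw [w2, z0, z1, z2]
    generalize cshA g = A at *
    generalize snhA g = S at *
    generalize hU z = u, hV z = v, hT z = t, ω.re = a, ω.im = b at *
    linear_combination (2 * S ^ 2 * b * (2 * S ^ 2 * (a * u + b * v) - 2 * A * S * t)) * hω
      + b * (4 * S ^ 2 * (a * u + b * v) - 2 * A * S * t) * hS

theorem pairing_neg_apply' {ω : ℂ} (hω : ω.re ^ 2 + ω.im ^ 2 = 1) (z : 𝔻) :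
    pairing g (-ω) (pairing g ω z) = z := by
  simpa using pairing_neg_apply hg (ω := -ω) (by simpa using hω) z

theorem pairing_mem_group {ω : ℂ} (hω : ω ^ (4 * g) = 1) : pairing g ω ∈ group g := by
  have : NeZero (4 * g) := ⟨by omega⟩
  obtain ⟨m, hm, rfl⟩ := (zeta_isPrimitiveRoot hg).eq_pow_of_pow_eq_one hω
  refine Subgroup.subset_closure ⟨m, hm, ?_⟩
  rw [pairing, sidePairing, coeffB, zeta_pow_eq hg, snhA, ang, mul_comm Complex.I]
  congr 5
  ring

/-- The pairing carries a side to the opposite one and exchanges inside and outside, hence the sign.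
-/
theorem sideFun_pairing_self {ω : ℂ} (hω : ω.re ^ 2 + ω.im ^ 2 = 1) (z : 𝔻) :
    sideFun g (-ω) (pairing g (-ω) z) = -sideFun g ω z := by
  obtain ⟨z0, z1, z2⟩ := pairing_coord hg (ω := -ω) (by simpa using hω) z
  have hS := snhA_sq hg
  simp only [Complex.neg_re, Complex.neg_im] at z0 z1 z2
  unfold sideFun
  rw [z0, z1, z2]
  simp only [Complex.neg_re, Complex.neg_im]
  generalize cshA g = A at *
  generalize snhA g = S at *
  generalize hU z = u, hV z = v, hT z = t, ω.re = a, ω.im = b at *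
  linear_combination (-A * (2 * S ^ 2 * (a * u + b * v) - 2 * A * S * t)) * hω - S * t * hS

/-- Three consecutive sides through a vertex make equal angles `ang g`, so their normals satisfy the
recurrence of a rotation by that angle. The value of the interior angle enters through
`cshA_sq_mul`. -/
theorem sideFun_pairing_next {ω μ : ℂ} (hω : ω.re ^ 2 + ω.im ^ 2 = 1)
    (hμ : μ.re = Real.cos (ang g)) (z : 𝔻) :
    sideFun g (-(ω * μ)) (pairing g (-ω) z) =
      2 * Real.cos (ang g) * sideFun g ω z + sideFun g (ω * conj μ) z := by
  obtain ⟨z0, z1, z2⟩ := pairing_coord hg (ω := -ω) (by simpa using hω) z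
  have hS := snhA_sq hg
  have hA := cshA_sq_mul hg
  simp only [Complex.neg_re, Complex.neg_im] at z0 z1 z2
  unfold sideFun
  rw [z0, z1, z2]
  simp only [Complex.neg_re, Complex.neg_im, Complex.mul_re, Complex.mul_im, Complex.conj_re,
    Complex.conj_im, hμ]
  generalize Real.cos (ang g) = c at *
  generalize cshA g = A at *
  generalize snhA g = S at *
  generalize hU z = u, hV z = v, hT z = t, ω.re = a, ω.im = b, μ.im = d at *
  linear_combination (-A * c * (2 * S ^ 2 * (a * u + b * v) - 2 * A * S * t)) * hω
    + (2 * A * (a * u + b * v) - 2 * S * t) * hA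
    + ((2 * A - 2 * A * c) * (a * u + b * v) - S * t) * hS

/-- The boost is the reflection in the side followed by the reflection in the parallel diameter (the
one perpendicular to ω). On the side the first is the identity, and the second sends direction ω ·
conj μ to −ωμ. -/
theorem sideFun_pairing_of_eq_zero {ω μ : ℂ} (hω : ω.re ^ 2 + ω.im ^ 2 = 1) {z : 𝔻}
    (hz : sideFun g ω z = 0) :
    sideFun g (-(ω * μ)) (pairing g (-ω) z) = sideFun g (ω * conj μ) z := by
  obtain ⟨z0, z1, z2⟩ := pairing_coord hg (ω := -ω) (by simpa using hω) z
  have hS := snhA_sq hg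
  simp only [Complex.neg_re, Complex.neg_im] at z0 z1 z2
  unfold sideFun at hz ⊢
  rw [z0, z1, z2]
  simp only [Complex.neg_re, Complex.neg_im, Complex.mul_re, Complex.mul_im, Complex.conj_re,
    Complex.conj_im]
  generalize cshA g = A at *
  generalize snhA g = S at *
  generalize hU z = u, hV z = v, hT z = t, ω.re = a, ω.im = b, μ.im = d, μ.re = c at *
  linear_combination (-A * c * (2 * S ^ 2 * (a * u + b * v) - 2 * A * S * t)) * hω
    - (2 * A ^ 2 * c - A ^ 2 - S ^ 2 + 1) * hz + A * (a * u + b * v) * (1 - 2 * c) * hS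

end

/-! ### The polygon as an intersection of half-planes -/

/-- The intersection of the half-planes bounded by the sides of the polygon. -/
def halfplaneInter (g : ℕ) : Set 𝔻 := {z | ∀ ω : ℂ, ω ^ (4 * g) = 1 → sideFun g ω z ≤ 0}

theorem IsComb.sideFun_eq {α β : ℝ} {z w x : 𝔻} (h : IsComb α β z w x) (g : ℕ) (ω : ℂ) :
    sideFun g ω x = α * sideFun g ω z + β * sideFun g ω w := by
  obtain ⟨h0, h1, h2⟩ := h
  unfold sideFun
  rw [h0, h1, h2]; ring

theorem hConvex_halfplaneInter (g : ℕ) : HConvex (halfplaneInter g) := by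
  intro z hz w hw x hx ω hω
  obtain ⟨α, β, hα, hβ, h⟩ := exists_isComb_of_mem_hsegment hx
  rw [h.sideFun_eq]
  nlinarith [hz ω hω, hw ω hω]

section
variable {g : ℕ} (hg : 2 ≤ g)
include hg

theorem vertex_coord (k : ℕ) : hT (vertex g k) = cshA g ^ 2 ∧
    Real.sin (ang g / 2) * hU (vertex g k) = snhA g * Real.cos (k * ang g - ang g / 2) ∧
    Real.sin (ang g / 2) * hV (vertex g k) = snhA g * Real.sin (k * ang g - ang g / 2) := by
  have hg' : (g : ℝ) ≠ 0 := by positivity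
  have hc := cos_ang_pos hg
  have hc1 := cos_ang_lt_one hg
  have hA := cshA_sq_mul hg
  have hS := snhA_sq hg
  have hsh := sin_half_pos hg
  have hco : (vertex g k : ℂ) = (Real.sqrt (Real.cos (ang g)) : ℝ) *
      Complex.exp ((k * ang g - ang g / 2 : ℝ) * Complex.I) := by
    rw [coe_vertex hg, vertexCoe, mul_comm Complex.I, ang]
    congr 4
    field_simp
    norm_num
    ring
  set φ := k * ang g - ang g / 2
  have hn : Complex.normSq (vertex g k) = Real.cos (ang g) := by
    rw [hco, Complex.normSq_mul, Complex.normSq_ofReal, Real.mul_self_sqrt hc.le,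
      Complex.normSq_eq_norm_sq, Complex.norm_exp_ofReal_mul_I]
    ring
  have hre : (vertex g k : ℂ).re = Real.sqrt (Real.cos (ang g)) * Real.cos φ := by
    rw [hco, Complex.re_ofReal_mul, Complex.exp_ofReal_mul_I_re]
  have him : (vertex g k : ℂ).im = Real.sqrt (Real.cos (ang g)) * Real.sin φ := by
    rw [hco, Complex.im_ofReal_mul, Complex.exp_ofReal_mul_I_im]
  have h1 : 1 - Real.cos (ang g) ≠ 0 := by linarith
  have hD : Real.sin (ang g / 2) * (2 * Real.sqrt (Real.cos (ang g)) / (1 - Real.cos (ang g)))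
      = snhA g := by
    rw [← sq_eq_sq₀ (by have : 0 < 1 - Real.cos (ang g) := by linarith
                        positivity) (snhA_pos hg).le, hS, mul_pow, div_pow, mul_pow,
      Real.sq_sqrt hc.le]
    have h2 := Real.sin_sq_add_cos_sq (ang g / 2)
    have h3 : Real.sin (ang g / 2) ^ 2 = (1 - Real.cos (ang g)) / 2 := by
      rw [cos_ang_eq]; linarith
    rw [h3]
    field_simp
    linear_combination -hA
  refine ⟨?_, ?_, ?_⟩
  · rw [hT, hn]
    field_simp
    linarith
  · rw [hU, hn, hre, ← hD]
    field_simp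
  · rw [hV, hn, him, ← hD]
    field_simp

theorem cos_odd_half_le (m k : ℕ) :
    Real.cos (m * ang g - (k * ang g - ang g / 2)) ≤ Real.cos (ang g / 2) := by
  have hp := two_mul_ang hg
  -- Twice the angle is (2m + 1 − 2k) `ang g`. N is a natural number congruent to that odd
  -- coefficient modulo 4g, so ζ^N ≠ 1, and the double-angle formula brings the bound back to the
  -- half angle.
  set N := 2 * m + 1 + (4 * g - 1) * (2 * k) with hN
  have hodd : ¬ 4 * g ∣ N := by
    intro h
    have h2 : 2 ∣ N := dvd_trans ⟨2 * g, by ring⟩ h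
    rw [hN] at h2
    have h3 : 2 ∣ (4 * g - 1) * (2 * k) := ⟨(4 * g - 1) * k, by ring⟩
    omega
  have hprim := zeta_isPrimitiveRoot hg
  have hle := re_le_of_ne_one hg (ω := zeta g ^ N)
    (by rw [← pow_mul, mul_comm, pow_mul, hprim.pow_eq_one, one_pow])
    (fun h => hodd (hprim.pow_eq_one_iff_dvd N |>.mp h))
  rw [zeta_pow_re hg] at hle
  have e : (N : ℝ) * ang g = 2 * (m * ang g - (k * ang g - ang g / 2))
      + (2 * k : ℕ) * (2 * Real.pi) := by
    have : (N : ℝ) = 2 * m + 1 + (4 * g - 1) * (2 * k) := by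
      rw [hN]; push_cast [Nat.cast_sub (show 1 ≤ 4 * g by omega)]; ring
    rw [this, ← hp]; push_cast; ring
  rw [e, Real.cos_add_nat_mul_two_pi, Real.cos_two_mul, cos_ang_eq] at hle
  exact le_of_sq_le_sq (by linarith) (cos_half_pos hg).le

theorem sin_mul_sideFun_vertex (m k : ℕ) :
    Real.sin (ang g / 2) * sideFun g (zeta g ^ m) (vertex g k) = cshA g * snhA g *
      (Real.cos (m * ang g - (k * ang g - ang g / 2)) - Real.cos (ang g / 2)) := by
  obtain ⟨h0, h1, h2⟩ := vertex_coord hg k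
  unfold sideFun
  rw [zeta_pow_re hg, zeta_pow_im hg, h0, ← cshA_mul_sin hg, Real.cos_sub]
  linear_combination (cshA g * Real.cos (m * ang g)) * h1 + (cshA g * Real.sin (m * ang g)) * h2

theorem vertex_mem_halfplaneInter (k : ℕ) : vertex g k ∈ halfplaneInter g := by
  intro ω hω
  have : NeZero (4 * g) := ⟨by omega⟩
  obtain ⟨m, -, rfl⟩ := (zeta_isPrimitiveRoot hg).eq_pow_of_pow_eq_one hω
  have hsh := sin_half_pos hg
  have hle := cos_odd_half_le hg m k
  have hAS := mul_pos (cshA_pos hg) (snhA_pos hg)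
  have key := sin_mul_sideFun_vertex hg m k
  by_contra! h
  nlinarith [mul_pos hsh h]

theorem polygon_subset_halfplaneInter : polygon g ⊆ halfplaneInter g := by
  apply hhull_subset _ (hConvex_halfplaneInter g)
  rintro _ ⟨k, rfl⟩
  exact vertex_mem_halfplaneInter hg k

omit hg in
theorem vertex_mem_polygon (k : ℕ) : vertex g k ∈ polygon g :=
  subset_hhull _ ⟨k, rfl⟩

theorem exists_center : ∃ o ∈ polygon g, hT o = 1 ∧ hU o = 0 ∧ hV o = 0 := by
  obtain ⟨o, h0, h1, h2⟩ := exists_hyperboloid_coord (t := 1) (u := 0) (v := 0) one_pos (by norm_num)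
  refine ⟨o, ?_, h0, h1, h2⟩
  obtain ⟨v0, v1, v2⟩ := vertex_coord hg 0
  obtain ⟨w0, w1, w2⟩ := vertex_coord hg (2 * g)
  have hp := two_mul_ang hg
  have hsh := sin_half_pos hg
  have hA := cshA_pos hg
  have e : ((2 * g : ℕ) : ℝ) * ang g - ang g / 2 = Real.pi - ang g / 2 := by
    push_cast; rw [hp]
  rw [e, Real.cos_pi_sub] at w1
  rw [e, Real.sin_pi_sub] at w2
  simp only [Nat.cast_zero, zero_mul, zero_sub, Real.cos_neg, Real.sin_neg] at v1 v2
  have hu : hU (vertex g 0) + hU (vertex g (2 * g)) = 0 := by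
    apply mul_left_cancel₀ hsh.ne'; linarith
  have hv : hV (vertex g 0) + hV (vertex g (2 * g)) = 0 := by
    apply mul_left_cancel₀ hsh.ne'; linarith
  -- The center is the midpoint of two opposite vertices, whose time coordinates are both `cshA g ^
  -- 2`.
  have hc : IsComb (1 / (2 * cshA g ^ 2)) (1 / (2 * cshA g ^ 2)) (vertex g 0) (vertex g (2 * g)) o := by
    refine ⟨?_, ?_, ?_⟩
    · rw [h0, v0, w0]; field_simp; norm_num
    · rw [h1, ← mul_add, hu, mul_zero]
    · rw [h2, ← mul_add, hv, mul_zero]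
  exact hConvex_hhull _ _ (vertex_mem_polygon 0) _ (vertex_mem_polygon (2 * g))
    (hc.mem_hsegment (by positivity) (by positivity))

/-- Take the direction with the largest inner product with (u, v). Comparing it with its two
neighbors bounds the angle by half of `ang g`, whose cotangent is `cshA g`. -/
theorem exists_sector (u v : ℝ) : ∃ k : ℕ,
    |(zeta g ^ k).re * v - (zeta g ^ k).im * u| * cshA g
      ≤ (zeta g ^ k).re * u + (zeta g ^ k).im * v := by
  have hprim := zeta_isPrimitiveRoot hg
  have : NeZero (4 * g) := ⟨by omega⟩
  obtain ⟨k, -, hk⟩ := Finset.exists_max_image (Finset.range (4 * g))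
    (fun k => (zeta g ^ k).re * u + (zeta g ^ k).im * v) ⟨0, Finset.mem_range.mpr (by omega)⟩
  have hk' : ∀ ω : ℂ, ω ^ (4 * g) = 1 → ω.re * u + ω.im * v ≤
      (zeta g ^ k).re * u + (zeta g ^ k).im * v := by
    intro ω hω
    obtain ⟨m, hm, rfl⟩ := hprim.eq_pow_of_pow_eq_one hω
    exact hk m (Finset.mem_range.mpr hm)
  refine ⟨k, ?_⟩
  have hω : (zeta g ^ k) ^ (4 * g) = 1 := by
    rw [← pow_mul, mul_comm, pow_mul, hprim.pow_eq_one, one_pow]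
  set ω := zeta g ^ k
  have h1 := hk' (ω * zeta g) (by rw [mul_pow, hω, hprim.pow_eq_one, one_mul])
  have h2 := hk' (ω * conj (zeta g))
    (by rw [mul_pow, hω, ← map_pow, hprim.pow_eq_one, map_one, one_mul])
  have hsh := sin_half_pos hg
  have hA := cshA_mul_sin hg
  have hs : Real.sin (ang g) = 2 * Real.sin (ang g / 2) * Real.cos (ang g / 2) := by
    rw [← Real.sin_two_mul]; ring_nf
  have hc : Real.cos (ang g) = 1 - 2 * Real.sin (ang g / 2) ^ 2 := by
    rw [cos_ang_eq]; linarith [Real.sin_sq_add_cos_sq (ang g / 2)]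
  simp only [Complex.mul_re, Complex.mul_im, Complex.conj_re, Complex.conj_im, zeta_re hg,
    zeta_im hg, hs, hc, ← hA] at h1 h2
  set p := ω.re * u + ω.im * v with hp
  set q := ω.re * v - ω.im * u with hq
  have hsq : 0 < 2 * Real.sin (ang g / 2) ^ 2 := by positivity
  have h1' : 2 * Real.sin (ang g / 2) ^ 2 * (q * cshA g) ≤ 2 * Real.sin (ang g / 2) ^ 2 * p := by
    rw [hp, hq]; linarith
  have h2' : 2 * Real.sin (ang g / 2) ^ 2 * (-q * cshA g) ≤ 2 * Real.sin (ang g / 2) ^ 2 * p := by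
    rw [hp, hq]; linarith
  rcases abs_cases q with ⟨h, -⟩ | ⟨h, -⟩
  · rw [h]; exact le_of_mul_le_mul_left h1' hsq
  · rw [h]; exact le_of_mul_le_mul_left h2' hsq

/-- In the sector of side k, the point is a combination of the center and the two endpoints of that
side. The sector inequality makes the vertex coefficients β, γ nonnegative, and the half-plane of
the side makes the coefficient α of the center nonnegative. -/
theorem halfplaneInter_subset_polygon : halfplaneInter g ⊆ polygon g := by
  intro z hz
  obtain ⟨o, ho, o0, o1, o2⟩ := exists_center hg
  obtain ⟨k, hk⟩ := exists_sector hg (hU z) (hV z)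
  have hω : (zeta g ^ k) ^ (4 * g) = 1 := by
    rw [← pow_mul, mul_comm, pow_mul, (zeta_isPrimitiveRoot hg).pow_eq_one, one_pow]
  have hside := hz _ hω
  have hunit := normSq_eq_one_of_pow hg hω
  unfold sideFun at hside
  obtain ⟨v0, v1, v2⟩ := vertex_coord hg k
  obtain ⟨w0, w1, w2⟩ := vertex_coord hg (k + 1)
  have e : ((k + 1 : ℕ) : ℝ) * ang g - ang g / 2 = k * ang g + ang g / 2 := by
    push_cast; ring
  rw [e, Real.cos_add, ← zeta_pow_re hg, ← zeta_pow_im hg] at w1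
  rw [e, Real.sin_add, ← zeta_pow_re hg, ← zeta_pow_im hg] at w2
  rw [Real.cos_sub, ← zeta_pow_re hg, ← zeta_pow_im hg] at v1
  rw [Real.sin_sub, ← zeta_pow_re hg, ← zeta_pow_im hg] at v2
  have hsh := sin_half_pos hg
  have hAs := cshA_mul_sin hg
  have hA := cshA_pos hg
  have hS := snhA_pos hg
  have hzv : vertex g k ∈ polygon g := vertex_mem_polygon k
  have hzw : vertex g (k + 1) ∈ polygon g := vertex_mem_polygon (k + 1)
  generalize vertex g k = V at *
  generalize vertex g (k + 1) = W at *
  generalize (zeta g ^ k).re = a at *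
  generalize (zeta g ^ k).im = b at *
  set p := a * hU z + b * hV z with hp
  set q := a * hV z - b * hU z with hq
  rw [← hAs] at v1 v2 w1 w2
  have V1 : hU V = snhA g * (a * cshA g + b) := by
    apply mul_left_cancel₀ hsh.ne'; linarith
  have V2 : hV V = snhA g * (b * cshA g - a) := by
    apply mul_left_cancel₀ hsh.ne'; linarith
  have W1 : hU W = snhA g * (a * cshA g - b) := by
    apply mul_left_cancel₀ hsh.ne'; linarith
  have W2 : hV W = snhA g * (b * cshA g + a) := by
    apply mul_left_cancel₀ hsh.ne'; linarith
  have hq1 := abs_le.mp (show |q| ≤ p / cshA g by rwa [le_div_iff₀ hA])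
  set β := (p / cshA g - q) / (2 * snhA g) with hβ
  set γ := (p / cshA g + q) / (2 * snhA g) with hγ
  have hβ0 : 0 ≤ β := div_nonneg (by linarith) (by positivity)
  have hγ0 : 0 ≤ γ := div_nonneg (by linarith) (by positivity)
  set α := hT z - cshA g * p / snhA g with hα
  have hα0 : 0 ≤ α := by
    rw [hα, sub_nonneg, div_le_iff₀ hS]; linarith
  have hcT : hT z = α * 1 + (β * hT V + γ * hT W) := by
    rw [hα, hβ, hγ, v0, w0]; field_simp; ring
  have hcU : hU z = β * hU V + γ * hU W := by
    rw [hβ, hγ, V1, W1]; field_simp; rw [hp, hq]; linear_combination (-2) * cshA g * hU z * hunit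
  have hcV : hV z = β * hV V + γ * hV W := by
    rw [hβ, hγ, V2, W2]; field_simp; rw [hp, hq]; linear_combination (-2) * cshA g * hV z * hunit
  rcases (add_nonneg hβ0 hγ0).eq_or_lt' with h0 | h0
  · have b0 : β = 0 := by linarith
    have c0 : γ = 0 := by linarith
    simp only [b0, c0, zero_mul, add_zero] at hcU hcV
    have hzo : z = o := by
      have hh := hyperboloid_eq z
      have hpos := hT_pos z
      rw [hcU, hcV] at hh
      have hsq : (hT z - 1) * (hT z + 1) = 0 := by linear_combination hh
      apply eq_of_hyperboloid_coord
      · rw [o0]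
        linarith [(mul_eq_zero.mp hsq).resolve_right (by linarith)]
      · rw [o1, hcU]
      · rw [o2, hcV]
    rw [hzo]; exact ho
  · obtain ⟨y, r, hr, hy⟩ := exists_isComb_smul V W hβ0 hγ0 h0
    have hyp : y ∈ polygon g := hConvex_hhull _ _ hzv _ hzw
      (hy.mem_hsegment (by positivity) (by positivity))
    obtain ⟨y0, y1, y2⟩ := hy
    have hzc : IsComb α r⁻¹ o y z := by
      refine ⟨?_, ?_, ?_⟩
      · rw [hcT, o0, y0]; field_simp
      · rw [hcU, o1, y1]; field_simp; ring
      · rw [hcV, o2, y2]; field_simp; ring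
    exact hConvex_hhull _ _ ho _ hyp (hzc.mem_hsegment hα0 (by positivity))

theorem polygon_eq_halfplaneInter : polygon g = halfplaneInter g :=
  (polygon_subset_halfplaneInter hg).antisymm (halfplaneInter_subset_polygon hg)

/-- A segment which leaves the polygon crosses a side. -/
theorem exists_exit {p x : 𝔻} (hp : p ∈ polygon g) (hx : x ∉ polygon g) :
    ∃ ω : ℂ, ω ^ (4 * g) = 1 ∧ ∃ q ∈ polygon g, q ∈ hsegment p x ∧ sideFun g ω q = 0 ∧
      0 < sideFun g ω x := by
  rw [polygon_eq_halfplaneInter hg] at *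
  have hprim := zeta_isPrimitiveRoot hg
  have : NeZero (4 * g) := ⟨by omega⟩
  have hpow : ∀ k : ℕ, (zeta g ^ k) ^ (4 * g) = 1 := fun k => by
    rw [← pow_mul, mul_comm, pow_mul, hprim.pow_eq_one, one_pow]
  have hne : ((Finset.range (4 * g)).filter fun k => 0 < sideFun g (zeta g ^ k) x).Nonempty := by
    by_contra h
    apply hx
    intro ω hω
    obtain ⟨m, hm, rfl⟩ := hprim.eq_pow_of_pow_eq_one hω
    by_contra! h'
    exact h ⟨m, Finset.mem_filter.mpr ⟨Finset.mem_range.mpr hm, h'⟩⟩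
  obtain ⟨k, hk, hmin⟩ := Finset.exists_min_image _
    (fun k => -sideFun g (zeta g ^ k) p / sideFun g (zeta g ^ k) x) hne
  have hkpos := (Finset.mem_filter.mp hk).2
  have hkp := hp _ (hpow k)
  -- The functional of side k vanishes at p + t x; minimality of t makes this the first side
  -- crossed, so the other functionals are still nonpositive there.
  set t := -sideFun g (zeta g ^ k) p / sideFun g (zeta g ^ k) x with ht
  have ht0 : 0 ≤ t := div_nonneg (by linarith) hkpos.le
  obtain ⟨q, r, hr, hq⟩ := exists_isComb_smul p x zero_le_one ht0 (by linarith)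
  refine ⟨zeta g ^ k, hpow k, q, ?_, hq.mem_hsegment (by positivity) (by positivity), ?_, hkpos⟩
  · intro ω hω
    obtain ⟨m, hm, rfl⟩ := hprim.eq_pow_of_pow_eq_one hω
    rw [hq.sideFun_eq, mul_one, mul_assoc, ← mul_add]
    apply mul_nonpos_of_nonneg_of_nonpos hr.le
    have hpm := hp _ hω
    rcases le_or_gt (sideFun g (zeta g ^ m) x) 0 with h | h
    · nlinarith
    · have := hmin m (Finset.mem_filter.mpr ⟨Finset.mem_range.mpr hm, h⟩)
      rw [le_div_iff₀ h] at this
      linarith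
  · rw [hq.sideFun_eq, ht]
    field_simp
    ring

/-- The distance between points on nonadjacent sides. -/
theorem le_mink_of_nonadjacent {ω ω' : ℂ} (hω : ω.re ^ 2 + ω.im ^ 2 = 1)
    (hω' : ω'.re ^ 2 + ω'.im ^ 2 = 1)
    (h : ω.re * ω'.re + ω.im * ω'.im ≤ 2 * Real.cos (ang g) ^ 2 - 1) {p q : 𝔻}
    (hp : sideFun g ω p = 0) (hq : sideFun g ω' q = 0) :
    1 + 2 * Real.cos (ang g) ≤ mink p q := by
  have hS := snhA_sq hg
  have hA := cshA_sq_mul hg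
  have hc := cos_ang_pos hg
  have hc1 := cos_ang_lt_one hg
  unfold sideFun at hp hq
  have key := abs_le_mink_of_orthogonal (p := p) (q := q) (m₀ := snhA g) (m₁ := cshA g * ω.re)
    (m₂ := cshA g * ω.im) (n₀ := snhA g) (n₁ := cshA g * ω'.re) (n₂ := cshA g * ω'.im)
    (by linear_combination hS - cshA g ^ 2 * hω) (by linear_combination hS - cshA g ^ 2 * hω')
    (by linear_combination -hp) (by linear_combination -hq)
  refine le_trans ?_ (le_trans (le_abs_self _) key)
  have h1 := mul_le_mul_of_nonneg_left h (sq_nonneg (cshA g))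
  -- The product of the two normals is at least this value, attained for directions two steps apart;
  -- it exceeds 1 + 2c.
  have h2 : cshA g ^ 2 - 1 - cshA g ^ 2 * (2 * Real.cos (ang g) ^ 2 - 1)
      = 2 * Real.cos (ang g) ^ 2 + 4 * Real.cos (ang g) + 1 := by
    linear_combination (2 * Real.cos (ang g) + 2) * hA
  nlinarith

/-- The distance between points on the outer sides of a zigzag of three sides. -/
theorem le_mink_of_zigzag {ω μ : ℂ} (hω : ω.re ^ 2 + ω.im ^ 2 = 1)
    (hμ : μ.re ^ 2 + μ.im ^ 2 = 1) (hμc : μ.re = Real.cos (ang g)) {p q : 𝔻}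
    (hp : 2 * Real.cos (ang g) * sideFun g ω p + sideFun g (ω * μ) p = 0)
    (hq : sideFun g (ω * conj μ) q = 0) :
    1 + 2 * Real.cos (ang g) ≤ mink p q := by
  have hS := snhA_sq hg
  have hA := cshA_sq_mul hg
  have hc := cos_ang_pos hg
  unfold sideFun at hp hq
  simp only [Complex.mul_re, Complex.mul_im, Complex.conj_re, Complex.conj_im] at hp hq
  rw [← hμc] at *
  generalize ω.re = a at *
  generalize ω.im = b at *
  generalize μ.re = c at *
  generalize μ.im = d at *
  generalize snhA g = S at *
  generalize cshA g = A at *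
  -- The first normal is that of the side of the previous region, expressed in the frame of the
  -- current one; its product with the second is (1 + 2c)².
  have key := abs_le_mink_of_orthogonal (p := p) (q := q) (m₀ := (2 * c + 1) * S)
    (m₁ := A * (2 * c * a + (a * c - b * d))) (m₂ := A * (2 * c * b + (a * d + b * c)))
    (n₀ := S) (n₁ := A * (a * c - b * -d)) (n₂ := A * (a * -d + b * c))
    (by linear_combination (2 * c + 1) ^ 2 * hS - A ^ 2 * (9 * c ^ 2 + d ^ 2) * hω - A ^ 2 * hμ
      + 4 * c * hA)
    (by linear_combination hS - A ^ 2 * (c ^ 2 + d ^ 2) * hω - A ^ 2 * hμ)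
    (by linear_combination -hp) (by linear_combination -hq)
  refine le_trans ?_ (le_trans (le_abs_self _) key)
  have : S * ((2 * c + 1) * S) - A * (a * c - b * -d) * (A * (2 * c * a + (a * c - b * d)))
      - A * (a * -d + b * c) * (A * (2 * c * b + (a * d + b * c))) = (1 + 2 * c) ^ 2 := by
    linear_combination (2 * c + 1) * hS - A ^ 2 * (3 * c ^ 2 - d ^ 2) * hω + A ^ 2 * hμ
      + 2 * (1 + 2 * c) * hA
  rw [this]
  nlinarith

end

theorem mink_le_of_hdist_le {a b c d : 𝔻} (h : hdist a b ≤ hdist c d) : mink a b ≤ mink c d := by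
  rwa [hdist_le_iff (hdist_nonneg _ _), cosh_hdist] at h

theorem neg_pow_four_mul {ω : ℂ} {g : ℕ} (h : ω ^ (4 * g) = 1) : (-ω) ^ (4 * g) = 1 := by
  rw [Even.neg_pow ⟨2 * g, by ring⟩, h]

section
variable {g : ℕ} (hg : 2 ≤ g)
include hg

/-! ### Neighboring regions -/

omit hg in
theorem apply_mem_neighborhoodDomain {γ : Equiv.Perm 𝔻} (hγ : γ ∈ group g) {x y : 𝔻}
    (hx : x ∈ polygon g) (hy : y ∈ polygon g) (hγy : γ y ∈ polygon g) :
    γ x ∈ neighborhoodDomain g :=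
  Set.mem_biUnion (x := γ) ⟨hγ, γ y, ⟨y, hy, rfl⟩, hγy⟩ ⟨x, hx, rfl⟩

theorem pairing_mem_polygon {ω : ℂ} (hω : ω ^ (4 * g) = 1) {z : 𝔻} (hz : z ∈ polygon g)
    (h : sideFun g ω z = 0) : pairing g (-ω) z ∈ polygon g := by
  have hu := normSq_eq_one_of_pow hg hω
  rw [polygon_eq_halfplaneInter hg] at *
  intro ν hν
  have hωc : ω * conj ω = 1 := by
    rw [Complex.mul_conj, Complex.normSq_apply, ← sq, ← sq, hu]; simp
  have e : ν = -(ω * -(conj ω * ν)) := by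
    linear_combination (-ν) * hωc
  rw [e, sideFun_pairing_of_eq_zero hg hu h]
  apply hz
  rw [mul_pow, hω, ← map_pow, neg_pow_four_mul, map_one, one_mul]
  rw [mul_pow, ← map_pow, hω, hν, map_one, one_mul]

theorem exists_common_vertex {ω μ : ℂ} (hω : ω ^ (4 * g) = 1)
    (hμ : μ = zeta g ∨ μ = conj (zeta g)) :
    ∃ y ∈ polygon g, sideFun g ω y = 0 ∧ sideFun g (ω * μ) y = 0 := by
  have : NeZero (4 * g) := ⟨by omega⟩
  have hprim := zeta_isPrimitiveRoot hg
  have hsh := sin_half_pos hg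
  have aux : ∀ k : ℕ, sideFun g (zeta g ^ k) (vertex g (k + 1)) = 0 ∧
      sideFun g (zeta g ^ (k + 1)) (vertex g (k + 1)) = 0 := by
    intro k
    have h1 := sin_mul_sideFun_vertex hg k (k + 1)
    have h2 := sin_mul_sideFun_vertex hg (k + 1) (k + 1)
    rw [show (k : ℝ) * ang g - (((k + 1 : ℕ) : ℝ) * ang g - ang g / 2) = -(ang g / 2) by
      push_cast; ring, Real.cos_neg, sub_self, mul_zero] at h1
    rw [sub_sub_cancel, sub_self, mul_zero] at h2
    exact ⟨(mul_eq_zero.mp h1).resolve_left hsh.ne', (mul_eq_zero.mp h2).resolve_left hsh.ne'⟩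
  obtain ⟨k, -, rfl⟩ := hprim.eq_pow_of_pow_eq_one hω
  rcases hμ with rfl | rfl
  · exact ⟨_, vertex_mem_polygon (k + 1), (aux k).1, by rw [← pow_succ]; exact (aux k).2⟩
  · refine ⟨_, vertex_mem_polygon (k + (4 * g - 1) + 1), ?_, ?_⟩
    · have := (aux (k + (4 * g - 1))).2
      rwa [show zeta g ^ (k + (4 * g - 1) + 1) = zeta g ^ k by
        rw [add_assoc, Nat.sub_add_cancel (by omega), pow_add, hprim.pow_eq_one, mul_one]] at this
    · rw [conj_zeta hg, ← pow_add]
      exact (aux (k + (4 * g - 1))).1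

/-- Rotating ω to 1 reduces this to the real part of the single root of unity conj ω · ω'. -/
theorem eq_or_adjacent_or_le {ω ω' μ : ℂ} (hω : ω ^ (4 * g) = 1) (hω' : ω' ^ (4 * g) = 1)
    (hμ : μ = zeta g ∨ μ = conj (zeta g)) : ω' = ω ∨ ω' = ω * μ ∨ ω' = ω * conj μ ∨
      ω.re * ω'.re + ω.im * ω'.im ≤ 2 * Real.cos (ang g) ^ 2 - 1 := by
  have hωc : ω * conj ω = 1 := by
    rw [Complex.mul_conj, Complex.normSq_apply, ← sq, ← sq, normSq_eq_one_of_pow hg hω]; simp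
  have e : ∀ ν, conj ω * ω' = ν → ω' = ω * ν := fun ν h => by
    rw [← h]; linear_combination (-ω') * hωc
  by_cases h1 : conj ω * ω' = 1
  · left; simpa using e _ h1
  by_cases h2 : conj ω * ω' = μ
  · exact Or.inr (Or.inl (e _ h2))
  by_cases h3 : conj ω * ω' = conj μ
  · exact Or.inr (Or.inr (Or.inl (e _ h3)))
  right; right; right
  have h := re_le_of_ne hg (ω := conj ω * ω')
    (by rw [mul_pow, ← map_pow, hω, hω', map_one, one_mul]) h1
    (by rcases hμ with rfl | rfl
        · exact h2
        · rwa [Complex.conj_conj] at h3)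
    (by rcases hμ with rfl | rfl
        · exact h3
        · exact h2)
  simpa [Complex.mul_re] using h

/-- A short segment which turns around a vertex stays in the neighborhood of the polygon. -/
theorem mem_of_turning {μ : ℂ} (hμ : μ = zeta g ∨ μ = conj (zeta g)) {b₀ b₁ : ℝ} (hb : 0 < b₀)
    (n : ℕ) : ∀ k : ℕ, k + n = 2 * g → ∀ γ ∈ group g, ∀ ω : ℂ, ω ^ (4 * g) = 1 →
    ∀ p q y x : 𝔻, sideFun g ω p = 0 → q ∈ polygon g → sideFun g (ω * μ) q = 0 →
    q ∈ hsegment p x → y ∈ polygon g → sideFun g ω y = 0 → sideFun g (ω * μ) y = 0 →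
    γ y ∈ polygon g → mink p x < 1 + 2 * Real.cos (ang g) →
    0 < sideFun g (ω * μ) x → 0 < -sideFun g ω x →
    Real.sin (ang g) * -sideFun g ω x = b₁ * Real.sin (k * ang g)
      - b₀ * Real.sin ((k - 1) * ang g) →
    Real.sin (ang g) * sideFun g (ω * μ) x = b₁ * Real.sin ((k + 1) * ang g)
      - b₀ * Real.sin (k * ang g) →
    γ x ∈ neighborhoodDomain g := by
  -- All points are in the frame of the current region γ D_g: p is the entry point, q the exit
  -- point, y the vertex turned about. With θ = `ang g`, the values at x of the functionals of
  -- successive sides at y form a sequence b with b_{k+1} = 2 cos θ b_k − b_{k−1}, so sin θ b_k = b₁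
  -- sin kθ − b₀ sin (k−1)θ. The induction is on the n = 2g − k regions left before a half turn.
  have hsin := sin_ang_pos hg
  have hpi := two_mul_ang hg
  have hprim := zeta_isPrimitiveRoot hg
  have hμ4 : μ ^ (4 * g) = 1 := by
    rcases hμ with rfl | rfl
    · exact hprim.pow_eq_one
    · rw [← map_pow, hprim.pow_eq_one, map_one]
  have hμre : μ.re = Real.cos (ang g) := by
    rcases hμ with rfl | rfl
    · exact zeta_re hg
    · rw [Complex.conj_re, zeta_re hg]
  have hμu := normSq_eq_one_of_pow hg hμ4
  have hμc : μ * conj μ = 1 := by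
    rw [Complex.mul_conj, Complex.normSq_apply, ← sq, ← sq, hμu]; simp
  induction n with
  | zero =>
    intro k hk γ hγ ω hω p q y x _ _ _ _ _ _ _ _ _ _ hpos hrec _
    exfalso
    have hk' : (k : ℝ) = 2 * g := by
      have : k = 2 * g := by omega
      rw [this]; push_cast; rfl
    -- After a half turn the closed form gives b_{2g} = −b₀ < 0, while x is still strictly past the
    -- side of entry.
    rw [sub_mul, one_mul, hk', hpi, Real.sin_pi_sub, Real.sin_pi] at hrec
    nlinarith [mul_pos hsin hpos, mul_pos hb hsin]
  | succ n ih =>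
    intro k hk γ hγ ω hω p q y x hp hq hq0 hseg hy hy0 hy1 hγy hd hx1 hx0 hrec0 hrec1
    have hj : (ω * μ) ^ (4 * g) = 1 := by rw [mul_pow, hω, hμ4, one_mul]
    have hωj : ω * μ * conj μ = ω := by linear_combination ω * hμc
    set j := ω * μ with hjdef
    have hju := normSq_eq_one_of_pow hg hj
    have hnju := normSq_eq_one_of_pow hg (neg_pow_four_mul hj)
    have hγ' : γ * pairing g j ∈ group g := mul_mem hγ (pairing_mem_group hg hj)
    have hback : ∀ z, (γ * pairing g j) (pairing g (-j) z) = γ z := fun z => by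
      rw [Equiv.Perm.mul_apply, pairing_neg_apply hg hju]
    have hself := sideFun_pairing_self hg hju
    have hnext := fun z => sideFun_pairing_next hg hju hμre z
    rw [hωj] at hnext
    have hy' := pairing_mem_polygon hg hj hy hy1
    have hq' := pairing_mem_polygon hg hj hq hq0
    rw [← hback x]
    by_cases hxD : pairing g (-j) x ∈ polygon g
    · exact apply_mem_neighborhoodDomain hγ' hxD hy' (by rwa [hback])
    obtain ⟨ν, hν, r, hr, hrseg, hr0, hrx⟩ := exists_exit hg hq' hxD
    have hqx : hdist (pairing g (-j) q) (pairing g (-j) x) = hdist q x := hdist_pairing hg hnju _ _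
    have hpq : hdist (pairing g (-j) p) (pairing g (-j) q) = hdist p q := hdist_pairing hg hnju _ _
    have hle : hdist q x ≤ hdist p x := hdist_le_of_mem_hsegment_right hseg
    have hseg' : hdist p q + hdist q x = hdist p x := hseg
    have hr1 := hdist_le_of_mem_hsegment_left hrseg
    -- The next exit is through the side of entry (excluded by sign), the next side about y
    -- (induction), the adjacent side at the other end (zigzag, too long), or a nonadjacent side
    -- (too long).
    rcases eq_or_adjacent_or_le hg (neg_pow_four_mul hj) hν hμ with h | h | h | h
    · rw [h, hself] at hrx
      linarith
    · subst h
      rw [neg_mul] at hr0 hrx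
      refine ih (k + 1) (by omega) _ hγ' (-j) (neg_pow_four_mul hj) (pairing g (-j) q) r
        (pairing g (-j) y) (pairing g (-j) x) ?_ hr ?_ hrseg hy' ?_ ?_ (by rwa [hback]) ?_ ?_ ?_ ?_ ?_
      · rw [hself, hq0, neg_zero]
      · rwa [neg_mul]
      · rw [hself, hy1, neg_zero]
      · rw [neg_mul, hnext, hy0, hy1]; ring
      · refine lt_of_le_of_lt (mink_le_of_hdist_le ?_) hd
        linarith
      · rwa [neg_mul]
      · rw [hself]; linarith
      · rw [hself, neg_neg, hrec1]; push_cast; ring_nf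
      · rw [neg_mul, hnext]
        have e1 : Real.sin (((k + 1 : ℕ) + 1) * ang g) =
            2 * Real.cos (ang g) * Real.sin ((k + 1) * ang g) - Real.sin (k * ang g) := by
          rw [show ((k + 1 : ℕ) + 1 : ℝ) * ang g = (k + 1) * ang g + ang g by push_cast; ring,
            show (k : ℝ) * ang g = (k + 1) * ang g - ang g by ring, Real.sin_add, Real.sin_sub]
          ring
        have e2 : Real.sin ((k + 1) * ang g) =
            2 * Real.cos (ang g) * Real.sin (k * ang g) - Real.sin ((k - 1) * ang g) := by
          rw [show (k + 1 : ℝ) * ang g = k * ang g + ang g by ring,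
            show (k - 1 : ℝ) * ang g = k * ang g - ang g by ring, Real.sin_add, Real.sin_sub]
          ring
        rw [e1]
        push_cast
        linear_combination 2 * Real.cos (ang g) * hrec1 - hrec0 + b₀ * e2
    · exfalso
      have hz := le_mink_of_zigzag hg hnju hμu hμre (p := pairing g (-j) p) (q := r)
        (by rw [hself, neg_mul, hnext, hp]; ring) (by rwa [← h])
      have := mink_le_of_hdist_le (a := pairing g (-j) p) (b := r) (c := p) (d := x) (by
        have := hdist_triangle (pairing g (-j) p) (pairing g (-j) q) r
        linarith)
      linarith
    · exfalso
      have hz := le_mink_of_nonadjacent hg hnju (normSq_eq_one_of_pow hg hν) h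
        (p := pairing g (-j) q) (q := r) (by rw [hself, hq0, neg_zero]) hr0
      have := mink_le_of_hdist_le (a := pairing g (-j) q) (b := r) (c := p) (d := x) (by linarith)
      linarith

/-- Points close to the polygon are contained in the neighborhood of the polygon. -/
theorem mem_neighborhoodDomain_of_mink_lt {p x : 𝔻} (hp : p ∈ polygon g)
    (h : mink p x < 1 + 2 * Real.cos (ang g)) : x ∈ neighborhoodDomain g := by
  by_cases hx : x ∈ polygon g
  · exact apply_mem_neighborhoodDomain (one_mem (group g)) hx hx hx
  obtain ⟨j, hj, q, hq, hqseg, hq0, hqx⟩ := exists_exit hg hp hx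
  have hju := normSq_eq_one_of_pow hg hj
  have hnj := neg_pow_four_mul hj
  have hnju := normSq_eq_one_of_pow hg hnj
  have hself := sideFun_pairing_self hg hju
  have hγ := pairing_mem_group hg hj
  have hq' := pairing_mem_polygon hg hj hq hq0
  have hqs : sideFun g (-j) (pairing g (-j) q) = 0 := by rw [hself, hq0, neg_zero]
  rw [← pairing_neg_apply hg hju x]
  by_cases hxD : pairing g (-j) x ∈ polygon g
  · exact apply_mem_neighborhoodDomain hγ hxD hq' (by rwa [pairing_neg_apply hg hju])
  obtain ⟨ν, hν, r, hr, hrseg, hr0, hrx⟩ := exists_exit hg hq' hxD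
  have hdqx : hdist (pairing g (-j) q) (pairing g (-j) x) = hdist q x := hdist_pairing hg hnju _ _
  have hle : hdist q x ≤ hdist p x := hdist_le_of_mem_hsegment_right hqseg
  have hr1 := hdist_le_of_mem_hsegment_left hrseg
  have hd : mink (pairing g (-j) q) (pairing g (-j) x) < 1 + 2 * Real.cos (ang g) :=
    lt_of_le_of_lt (mink_le_of_hdist_le (by linarith)) h
  have turn : ∀ μ : ℂ, (μ = zeta g ∨ μ = conj (zeta g)) → ν = -j * μ →
      pairing g j (pairing g (-j) x) ∈ neighborhoodDomain g := by
    rintro μ hμ rfl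
    obtain ⟨y, hy, hy0, hy1⟩ := exists_common_vertex hg hnj hμ
    have hyp := pairing_mem_polygon hg hnj hy hy0
    rw [neg_neg] at hyp
    have hpos : 0 < -sideFun g (-j) (pairing g (-j) x) := by rw [hself]; linarith
    -- At k = 0 both closed forms are identities, so b₀ and b₁ are just the values at the first two
    -- sides.
    exact mem_of_turning hg hμ hpos (b₁ := sideFun g (-j * μ) (pairing g (-j) x)) (2 * g) 0
      (by omega) _ hγ _ hnj _ r y _ hqs hr hr0 hrseg hy hy0 hy1 hyp hd hrx hpos
      (by simp; ring) (by simp; ring)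
  rcases eq_or_adjacent_or_le hg hnj hν (Or.inl rfl) with h' | h' | h' | h'
  · rw [h', hself] at hrx
    linarith
  · exact turn _ (Or.inl rfl) h'
  · exact turn _ (Or.inr rfl) h'
  · exfalso
    have hz := le_mink_of_nonadjacent hg hnju (normSq_eq_one_of_pow hg hν) h' hqs hr0
    have := mink_le_of_hdist_le (a := pairing g (-j) q) (b := r) (c := p) (d := x) (by linarith)
    linarith

/-! ### The systole -/

theorem exists_side_midpoint {ω : ℂ} (hω : ω.re ^ 2 + ω.im ^ 2 = 1) :
    ∃ z : 𝔻, hT z = cshA g ∧ hU z = snhA g * ω.re ∧ hV z = snhA g * ω.im :=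
  exists_hyperboloid_coord (cshA_pos hg) (by linear_combination (-snhA g ^ 2) * hω - snhA_sq hg)

theorem pairing_side_midpoint {ω : ℂ} (hω : ω.re ^ 2 + ω.im ^ 2 = 1) {z w : 𝔻}
    (hz : hT z = cshA g ∧ hU z = snhA g * ω.re ∧ hV z = snhA g * ω.im)
    (hw : hT w = cshA g ∧ hU w = snhA g * (-ω).re ∧ hV w = snhA g * (-ω).im) :
    pairing g (-ω) z = w := by
  obtain ⟨z0, z1, z2⟩ := hz
  obtain ⟨w0, w1, w2⟩ := hw
  obtain ⟨p0, p1, p2⟩ := pairing_coord hg (ω := -ω) (by simpa using hω) z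
  have hS := snhA_sq hg
  simp only [Complex.neg_re, Complex.neg_im] at *
  apply eq_of_hyperboloid_coord
  · rw [p0, w0, z0, z1, z2]
    linear_combination (-2 * cshA g * snhA g ^ 2) * hω - cshA g * hS
  · rw [p1, w1, z0, z1, z2]
    linear_combination (2 * snhA g ^ 3 * ω.re) * hω + 2 * snhA g * ω.re * hS
  · rw [p2, w2, z0, z1, z2]
    linear_combination (2 * snhA g ^ 3 * ω.im) * hω + 2 * snhA g * ω.im * hS

theorem pairing_mul_pairing_ne_one : pairing g 1 * pairing g (-zeta g) ≠ 1 := by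
  intro h
  have hzu := normSq_eq_one_of_pow hg (zeta_isPrimitiveRoot hg).pow_eq_one
  obtain ⟨o, -, o0, o1, o2⟩ := exists_center hg
  -- If the product were the identity, the center would have the same image under the pairings in
  -- directions ζ and 1; only the second image lies on the real axis.
  have h1 := congrArg (fun f => f (pairing g (zeta g) o)) h
  simp only [Equiv.Perm.mul_apply, Equiv.Perm.one_apply, pairing_neg_apply' hg hzu] at h1
  have h2 := (pairing_coord hg (ω := 1) (by simp) o).2.2
  have h3 := (pairing_coord hg hzu o).2.2
  rw [h1, h3, o0, o1, o2, zeta_im hg] at h2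
  simp at h2
  rcases h2 with h2 | h2 | h2
  · exact (sin_ang_pos hg).ne' h2
  · exact (cshA_pos hg).ne' h2
  · exact (snhA_pos hg).ne' h2

/-- Take the midpoints m, n of the sides in directions ζ and 1. The element `pairing g 1 * pairing g
(-zeta g)` sends m to a point at distance d(m, n) from n, by the central symmetry of the polygon, so
it displaces m by at most 2 d(m, n). -/
theorem exists_systole_le : ∃ a b : 𝔻, mink a b = 1 + 2 * Real.cos (ang g) ∧
    systole g / 2 ≤ hdist a b := by
  have hz4 := (zeta_isPrimitiveRoot hg).pow_eq_one
  have hzu := normSq_eq_one_of_pow hg hz4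
  have h1u : (1 : ℂ).re ^ 2 + (1 : ℂ).im ^ 2 = 1 := by simp
  obtain ⟨m, hm⟩ := exists_side_midpoint hg hzu
  obtain ⟨m', hm'⟩ := exists_side_midpoint hg (ω := -zeta g) (by simpa using hzu)
  obtain ⟨n, hn⟩ := exists_side_midpoint hg h1u
  obtain ⟨n', hn'⟩ := exists_side_midpoint hg (ω := -1) (by simp)
  have e1 : pairing g (-zeta g) m = m' := pairing_side_midpoint hg hzu hm hm'
  have e2 : pairing g 1 n' = n := by
    have := pairing_side_midpoint hg (ω := -1) (z := n') (w := n) (by simp) hn'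
      (by rwa [neg_neg])
    rwa [neg_neg] at this
  have hS := snhA_sq hg
  have hA := cshA_sq_mul hg
  have hmn : mink m n = 1 + 2 * Real.cos (ang g) := by
    obtain ⟨a0, a1, a2⟩ := hm
    obtain ⟨b0, b1, b2⟩ := hn
    unfold mink
    rw [a0, a1, a2, b0, b1, b2, zeta_re hg]
    simp
    linear_combination hA - Real.cos (ang g) * hS
  have hmn' : mink n' m' = mink m n := by
    obtain ⟨a0, a1, a2⟩ := hm
    obtain ⟨b0, b1, b2⟩ := hn
    obtain ⟨c0, c1, c2⟩ := hm'
    obtain ⟨d0, d1, d2⟩ := hn'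
    unfold mink
    rw [a0, a1, a2, b0, b1, b2, c0, c1, c2, d0, d1, d2]
    simp
    ring
  refine ⟨m, n, hmn, ?_⟩
  have hsys : systole g ≤ hdist m ((pairing g 1 * pairing g (-zeta g)) m) := by
    apply csInf_le ⟨0, ?_⟩
    · exact ⟨_, mul_mem (pairing_mem_group hg (one_pow _))
        (pairing_mem_group hg (neg_pow_four_mul hz4)), pairing_mul_pairing_ne_one hg, m, rfl⟩
    · rintro L ⟨f, -, -, z, rfl⟩
      exact hdist_nonneg _ _
  have htri := hdist_triangle m n (pairing g 1 m')
  have h2 : hdist n (pairing g 1 m') = hdist m n := by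
    rw [← e2, hdist_pairing hg h1u, e2]
    exact hdist_eq_of_mink_eq hmn'
  rw [Equiv.Perm.mul_apply, e1] at hsys
  linarith

theorem mem_neighborhoodDomain_of_hdist_lt {p x : 𝔻} (hp : p ∈ polygon g)
    (h : hdist p x < systole g / 2) : x ∈ neighborhoodDomain g := by
  obtain ⟨a, b, hab, hs⟩ := exists_systole_le hg
  apply mem_neighborhoodDomain_of_mink_lt hg hp
  by_contra! hcon
  rw [← hab, ← cosh_hdist p x, ← hdist_le_iff (hdist_nonneg _ _)] at hcon
  linarith

omit hg in
theorem originalDomain_subset_polygon (g : ℕ) : originalDomain g ⊆ polygon g := by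
  rintro z ((hz | hz) | hz)
  · exact interior_subset hz
  · rw [Set.mem_singleton_iff] at hz
    rw [hz]; exact vertex_mem_polygon 0
  · simp only [Set.mem_iUnion] at hz
    obtain ⟨j, -, hz, -⟩ := hz
    exact hConvex_hhull _ _ (vertex_mem_polygon j) _ (vertex_mem_polygon (j + 1)) hz

end

end GenBolza

end

/-! ### The inclusion property and the boundary distance. -/

theorem mainTheorem8 (g : ℕ) (hg : 2 ≤ g) :
    (∀ a b c : 𝔻, GenBolza.IsAdmissible g a b c →
      (a ∈ GenBolza.originalDomain g ∨ b ∈ GenBolza.originalDomain g ∨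
        c ∈ GenBolza.originalDomain g) →
      GenBolza.triangle a b c ⊆ GenBolza.neighborhoodDomain g) ∧
    (∀ p ∈ frontier (GenBolza.polygon g), ∀ q ∈ frontier (GenBolza.neighborhoodDomain g),
      GenBolza.systole g / 2 ≤ GenBolza.hdist p q) := by
  refine ⟨?_, ?_⟩
  · rintro a b c ⟨o, R, ha, hb, hc, hR⟩ habc x hx
    have hR0 : 0 ≤ R := ha ▸ GenBolza.hdist_nonneg o a
    have hox : GenBolza.hdist o x ≤ R := GenBolza.hhull_subset
      (t := {x | GenBolza.hdist o x ≤ R})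
      (by rintro y (rfl | rfl | rfl) <;> simp [ha, hb, hc])
      (GenBolza.hConvex_closedBall o hR0) hx
    obtain ⟨d, hd, hdR⟩ : ∃ d ∈ GenBolza.originalDomain g, GenBolza.hdist o d = R := by
      rcases habc with h | h | h
      · exact ⟨a, h, ha⟩
      · exact ⟨b, h, hb⟩
      · exact ⟨c, h, hc⟩
    apply GenBolza.mem_neighborhoodDomain_of_hdist_lt hg
      (GenBolza.originalDomain_subset_polygon g hd)
    have := GenBolza.hdist_triangle d o x
    rw [GenBolza.hdist_comm d o] at this
    linarith
  · intro p hp q hq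
    by_contra! h
    -- A nearby point p' of the polygon replaces p, so closedness of the polygon is not needed.
    have hp' := mem_closure_iff.mp (frontier_subset_closure hp)
      {p' | GenBolza.hdist q p' < GenBolza.systole g / 2}
      (isOpen_lt (GenBolza.continuous_hdist_right q) continuous_const)
      (by rwa [Set.mem_ofPred_eq, GenBolza.hdist_comm])
    obtain ⟨p', hpq, hpD⟩ := hp'
    rw [Set.mem_ofPred_eq, GenBolza.hdist_comm] at hpq
    apply hq.2
    exact mem_interior.mpr ⟨{q' | GenBolza.hdist p' q' < GenBolza.systole g / 2},
      fun q' hq' => GenBolza.mem_neighborhoodDomain_of_hdist_lt hg hpD hq',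
      isOpen_lt (GenBolza.continuous_hdist_right p') continuous_const, hpq⟩
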